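/- Let $p_1, p_2, q$ be primes with $p_1\neq p_2$, $p_1\equiv p_2\equiv 1\pmod 4$ and $q\equiv 3\pmod 4$. Put $k=\mathbb{Q}(\sqrt{p_1p_2q},\,i)$ with $i=\sqrt{-1}$. Let $\mathrm{Cl}_2(k)$ be the $2$-Sylow subgroup of the ideal class group $\mathrm{Cl}(k)$. Let $k^{(*)}$ be the absolute genus field of $k$, i.e. the maximal unramified extension of $k$ that is the compositum of $k$ with an abelian extension of $\mathbb{Q}$. Let $\kappa_{k^{(*)}}$ be the kernel of the homomorphism $\mathrm{Cl}(k)\to\mathrm{Cl}(k^{(*)})$ induced by extension of ideals. Let $\mathrm{Am}(k/\mathbb{Q}(i))$ be the group of ideal classes of $k$ fixed by every element of $\mathrm{Gal}(k/\mathbb{Q}(i))$, and let $\mathrm{Am}_s(k/\mathbb{Q}(i))$ be the subgroup of those classes in $\mathrm{Am}(k/\mathbb{Q}(i))$ that contain at least one ideal invariant under $\mathrm{Gal}(k/\mathbb{Q}(i))$. If $\mathrm{Cl}_2(k)\cong(\mathbb{Z}/2\mathbb{Z})^3$, then every class of $\mathrm{Cl}_2(k)$ becomes trivial in $\mathrm{Cl}(k^{(*)})$.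 Moreover, $$\kappa_{k^{(*)}}=\mathrm{Cl}_2(k)=\mathrm{Am}(k/\mathbb{Q}(i))=\mathrm{Am}_s(k/\mathbb{Q}(i)).$$ -/

import Mathlib

open scoped NumberField nonZeroDivisors Pointwise

noncomputable section

namespace Capitulation

/-- The `2`-class group of `k`: the `2`-primary part (the `2`-Sylow subgroup) of the ideal class
group of `k`. -/
def twoClassGroup (k : Type*) [Field k] : Subgroup (ClassGroup (𝓞 k)) :=
  CommGroup.primaryComponent (ClassGroup (𝓞 k)) 2

/-- The capitulation kernel of `L / k`: the kernel of the homomorphism `Cl(k) → Cl(L)` induced by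
extension of ideals. -/
def capitulationKernel (k L : Type*) [Field k] [Field L] [Algebra k L] :
    Subgroup (ClassGroup (𝓞 k)) :=
  (ClassGroup.extendedHom (𝓞 k) (𝓞 L)).ker

/-- `L / k` is unramified at all finite primes and at all infinite places. -/
def IsUnramifiedExtension (k L : Type*) [Field k] [Field L] [Algebra k L] : Prop :=
  (∀ (P : Ideal (𝓞 L)) [P.IsPrime], P ≠ ⊥ → Algebra.IsUnramifiedAt (𝓞 k) P) ∧
    IsUnramifiedAtInfinitePlaces k L

/-- The extensions of `k` inside `Ω` which are finite and unramified over `k` and are the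
compositum of `k` with an abelian extension `M` of `ℚ`. -/
def genusExtensions (k Ω : Type*) [Field k] [Field Ω] [CharZero Ω] [Algebra k Ω] :
    Set (IntermediateField k Ω) :=
  {L | FiniteDimensional k L ∧ IsUnramifiedExtension k L ∧
    ∃ M : IntermediateField ℚ Ω, IsAbelianGalois ℚ M ∧
      L = IntermediateField.adjoin k (M : Set Ω)}

/-- The absolute genus field `k^(*)` of a number field `k`, inside an algebraically closed field
`Ω` containing `k`: the maximal unramified extension of `k` obtained by composing `k` with an
abelian extension of `ℚ`, realised as the compositum of all extensions of this kind. -/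
def genusField (k Ω : Type*) [Field k] [Field Ω] [CharZero Ω] [Algebra k Ω] :
    IntermediateField k Ω :=
  sSup (genusExtensions k Ω)

section Ambiguous

variable (F k : Type*) [Field F] [Field k] [Algebra F k]

variable {F k} in
/-- The conjugate `σ(I)` of a nonzero ideal `I` of `𝓞 k` under `σ ∈ Gal(k/F)`. -/
def conjIdeal (σ : Gal(k/F)) (I : (Ideal (𝓞 k))⁰) : (Ideal (𝓞 k))⁰ :=
  ⟨σ • (I : Ideal (𝓞 k)), by
    rw [mem_nonZeroDivisors_iff_ne_zero]
    intro h
    apply nonZeroDivisors.ne_zero I.2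
    rw [← inv_smul_smul σ (I : Ideal (𝓞 k)), h, smul_zero]⟩

variable {F k} in
theorem conjIdeal_mul (σ : Gal(k/F)) (I J : (Ideal (𝓞 k))⁰) :
    conjIdeal σ (I * J) = conjIdeal σ I * conjIdeal σ J :=
  Subtype.ext (smul_mul' σ (I : Ideal (𝓞 k)) (J : Ideal (𝓞 k)))

variable {F k} in
theorem conjIdeal_one (σ : Gal(k/F)) : conjIdeal σ (1 : (Ideal (𝓞 k))⁰) = 1 :=
  Subtype.ext (smul_one σ)

variable [NumberField k]

variable {F k} in
theorem mk0_conjIdeal_congr (σ : Gal(k/F)) {I J : (Ideal (𝓞 k))⁰}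
    (h : ClassGroup.mk0 I = ClassGroup.mk0 J) :
    ClassGroup.mk0 (conjIdeal σ I) = ClassGroup.mk0 (conjIdeal σ J) := by
  rw [ClassGroup.mk0_eq_mk0_iff] at h ⊢
  obtain ⟨x, y, hx, hy, hxy⟩ := h
  have hspan : ∀ z : 𝓞 k, σ • Ideal.span {z} = Ideal.span {σ • z} := by
    intro z
    rw [Ideal.pointwise_smul_def, Ideal.map_span, Set.image_singleton]
    rfl
  refine ⟨σ • x, σ • y, (smul_ne_zero_iff_ne σ).2 hx, (smul_ne_zero_iff_ne σ).2 hy, ?_⟩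
  have := congrArg (fun K : Ideal (𝓞 k) => σ • K) hxy
  simp only [smul_mul', hspan] at this
  exact this

/-- The action of `σ ∈ Gal(k/F)` on the ideal class group: `[I] ↦ [σ(I)]`. -/
def conjClass (σ : Gal(k/F)) : ClassGroup (𝓞 k) →* ClassGroup (𝓞 k) where
  toFun c := ClassGroup.mk0 (conjIdeal σ (ClassGroup.mk0_surjective c).choose)
  map_one' := by
    rw [mk0_conjIdeal_congr σ (J := 1)
      ((ClassGroup.mk0_surjective (1 : ClassGroup (𝓞 k))).choose_spec.trans (map_one _).symm),
      conjIdeal_one, map_one]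
  map_mul' c d := by
    rw [← map_mul, ← conjIdeal_mul]
    apply mk0_conjIdeal_congr
    rw [map_mul, (ClassGroup.mk0_surjective (c * d)).choose_spec,
      (ClassGroup.mk0_surjective c).choose_spec, (ClassGroup.mk0_surjective d).choose_spec]

theorem conjClass_mk0 (σ : Gal(k/F)) (I : (Ideal (𝓞 k))⁰) :
    conjClass F k σ (ClassGroup.mk0 I) = ClassGroup.mk0 (conjIdeal σ I) :=
  mk0_conjIdeal_congr σ (ClassGroup.mk0_surjective (ClassGroup.mk0 I)).choose_spec

/-- `Am(k/F)`: the group of ambiguous classes of `k/F`, that is, of the ideal classes of `k` fixed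
by every element of `Gal(k/F)`. -/
def ambiguousClasses : Subgroup (ClassGroup (𝓞 k)) where
  carrier := {c | ∀ σ : Gal(k/F), conjClass F k σ c = c}
  one_mem' σ := map_one _
  mul_mem' hc hd σ := by rw [map_mul, hc σ, hd σ]
  inv_mem' hc σ := by rw [map_inv, hc σ]

/-- `Am_s(k/F)`: the group of strongly ambiguous classes of `k/F`, that is, of the ambiguous
classes containing at least one ideal invariant under every element of `Gal(k/F)`. -/
def stronglyAmbiguousClasses : Subgroup (ClassGroup (𝓞 k)) where
  carrier := {c | c ∈ ambiguousClasses F k ∧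
    ∃ I : (Ideal (𝓞 k))⁰, ClassGroup.mk0 I = c ∧ ∀ σ : Gal(k/F), conjIdeal σ I = I}
  one_mem' := ⟨one_mem _, 1, map_one _, conjIdeal_one⟩
  mul_mem' := by
    rintro _ _ ⟨hc, I, rfl, hI⟩ ⟨hd, J, rfl, hJ⟩
    exact ⟨mul_mem hc hd, I * J, map_mul _ _ _, fun σ => by rw [conjIdeal_mul, hI, hJ]⟩
  inv_mem' := by
    rintro _ ⟨hc, I, rfl, hI⟩
    refine ⟨inv_mem hc, I ^ (orderOf (ClassGroup.mk0 I) - 1), ?_, fun σ => ?_⟩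
    · rw [map_pow]
      refine eq_inv_of_mul_eq_one_left ?_
      rw [← pow_succ, Nat.sub_add_cancel (orderOf_pos _), pow_orderOf_eq_one]
    · generalize orderOf (ClassGroup.mk0 I) - 1 = n
      induction n with
      | zero => rw [pow_zero, conjIdeal_one]
      | succ n ih => rw [pow_succ, conjIdeal_mul, ih, hI]

end Ambiguous

/-- The field `ℚ(√d, i)`, as a subfield of `ℂ`. -/
def biquadraticField (d : ℕ) : IntermediateField ℚ ℂ :=
  IntermediateField.adjoin ℚ {((Real.sqrt d : ℝ) : ℂ), Complex.I}

instance (d : ℕ) : NumberField (biquadraticField d) where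
  to_finiteDimensional := by
    apply IntermediateField.finiteDimensional_adjoin
    intro x hx
    rcases hx with rfl | rfl
    · refine IsIntegral.of_pow (n := 2) two_pos ?_
      rw [← Complex.ofReal_pow, Real.sq_sqrt (Nat.cast_nonneg d), Complex.ofReal_natCast]
      exact isIntegral_algebraMap (R := ℚ) (x := (d : ℚ)) |> fun h => by simpa using h
    · refine IsIntegral.of_pow (n := 2) two_pos ?_
      rw [Complex.I_sq]
      exact isIntegral_one.neg

/-- The subfield `ℚ(i)` of `ℚ(√d, i)`. -/
def gaussianSubfield (d : ℕ) : IntermediateField ℚ (biquadraticField d) :=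
  IntermediateField.adjoin ℚ
    {(⟨Complex.I, IntermediateField.subset_adjoin ℚ
      ({((Real.sqrt d : ℝ) : ℂ), Complex.I} : Set ℂ) (Set.mem_insert_of_mem _ rfl)⟩ :
      biquadraticField d)}

end Capitulation

end

open scoped NumberField nonZeroDivisors Pointwise

noncomputable section

namespace Capitulation

/-! Put d = p₁p₂q and F = ℚ(i), so k = F(√d). In ℤ[i], d is a product of five non-associated primes
ϖ: π₁, π̄₁, π₂, π̄₂ and q. Each gives a Galois-invariant ideal P = (ϖ, √d) with P² = (ϖ), so
products of the P's represent strongly ambiguous classes.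

Each class contains at most four of these 32 products (`card_fiber_le_four`). If P_S and P_T are
equivalent, then α² is a unit times ∏_S ϖ / ∏_T ϖ for some α in k, and σ(α)/α is a unit of relative
norm 1. Modulo squares of such units it determines S, and the squares have index at most 4 because k
is totally complex of degree at most 4. Hence at least 8 classes arise. All are ambiguous, and
ambiguous classes have order dividing 2 since ℤ[i] is principal. As Cl₂(k) has 8 elements, it
consists exactly of these classes, and Cl₂ ≤ Am_s ≤ Am ≤ Cl₂ gives the equalities.

For capitulation, the genus field contains √p₁, √p₂ and √q (`mem_genusField_of_sq_eq`). A solution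
of x² + 1 = p y² makes x + y√p a unit and lets a unit multiple of π become a square once √p is
available (`exists_sq_eq_unit_mul`); q is itself the square of √q. Thus each P becomes principal.

Conversely, ramification and Minkowski's theorem force each abelian field entering the genus field
to have 2-power degree, so every element of the genus field has 2-power degree over k. If an ideal
becomes (γ) there, taking the norm from k(γ) shows that a 2-power of it is principal
(`capitulationKernel_le_twoClassGroup`). Finiteness of the genus field over k is never needed. -/

/-! ### Negative Pell equation and splitting of primes in ℤ[i] -/

/-- If `m n = p b²` with `m`, `n` coprime and `p ∣ m`, then `m / p` and `n` are squares. -/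
theorem exists_sq_of_mul_eq_mul_sq {p : ℤ} (hp0 : 0 < p) {m n b : ℤ}
    (hm : 0 ≤ m) (hn : 0 ≤ n) (hmn : IsCoprime m n) (h : m * n = p * b ^ 2) (hdvd : p ∣ m) :
    ∃ s t : ℤ, m = p * s ^ 2 ∧ n = t ^ 2 := by
  obtain ⟨m', rfl⟩ := hdvd
  have hcop : IsCoprime m' n := hmn.of_isCoprime_of_dvd_left (Dvd.intro_left _ rfl)
  have h' : m' * n = b ^ 2 := by
    apply mul_left_cancel₀ hp0.ne'
    linear_combination h
  have hm' : 0 ≤ m' := nonneg_of_mul_nonneg_right hm hp0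
  obtain ⟨s, hs⟩ := Int.sq_of_isCoprime hcop h'
  obtain ⟨t, ht⟩ := Int.sq_of_isCoprime hcop.symm (by rw [mul_comm]; exact h')
  refine ⟨s, t, ?_, ?_⟩
  · rcases hs with hs | hs
    · rw [hs]
    · have : s ^ 2 = 0 := by nlinarith [sq_nonneg s]
      rw [hs, this]; simp
  · rcases ht with ht | ht
    · exact ht
    · nlinarith [sq_nonneg t]

/-- The negative Pell equation `x² - p y² = -1` is solvable for every prime `p ≡ 1 [MOD 4]`. -/
theorem exists_sq_add_one_eq_prime_mul_sq {p : ℕ} (hp : p.Prime) (hp4 : p ≡ 1 [MOD 4]) :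
    ∃ x y : ℤ, x ^ 2 + 1 = p * y ^ 2 := by
  have hpZ : Prime (p : ℤ) := Nat.prime_iff_prime_int.mp hp
  have hp0 : (0 : ℤ) < p := by exact_mod_cast hp.pos
  have hp4' : (p : ℤ) % 4 = 1 := by
    have : p % 4 = 1 := hp4
    omega
  have hsq : ¬ IsSquare (p : ℤ) := hpZ.irreducible.not_isSquare
  -- Descent from the fundamental solution of X² - pY² = 1: reduction mod 4 makes Y even and X odd,
  -- so X = 2m + 1, Y = 2b and m(m + 1) = p b².
  obtain ⟨a, ha⟩ := Pell.IsFundamental.exists_of_not_isSquare hp0 hsq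
  obtain ⟨ha1, hay, hmin⟩ := ha
  have hP := a.prop
  generalize hX : a.x = X at *
  generalize hY : a.y = Y at *
  have hYe : Y % 2 = 0 := by
    by_contra hodd
    have hY1 : Y % 4 = 1 ∨ Y % 4 = 3 := by omega
    have h1 : (p * Y ^ 2) % 4 = 1 := by
      rcases hY1 with h | h <;> simp [Int.mul_emod, pow_two, hp4', h]
    have h2 : X % 4 = 0 ∨ X % 4 = 1 ∨ X % 4 = 2 ∨ X % 4 = 3 := by omega
    have h3 : (X ^ 2) % 4 = 0 ∨ (X ^ 2) % 4 = 1 := by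
      rcases h2 with h | h | h | h <;> simp [Int.mul_emod, pow_two, h]
    omega
  obtain ⟨b, rfl⟩ : ∃ b, Y = 2 * b := ⟨Y / 2, by omega⟩
  have hXo : X % 2 = 1 := by
    by_contra hev
    obtain ⟨c, rfl⟩ : ∃ c, X = 2 * c := ⟨X / 2, by omega⟩
    have : 4 * (c ^ 2 - p * b ^ 2) = 1 := by linear_combination hP
    omega
  obtain ⟨m, rfl⟩ : ∃ m, X = 2 * m + 1 := ⟨X / 2, by omega⟩
  have hmb : m * (m + 1) = p * b ^ 2 := by
    have : 4 * (m * (m + 1)) = 4 * (p * b ^ 2) := by linear_combination hP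
    linarith
  have hm : 0 < m := by omega
  have hcop : IsCoprime m (m + 1) := ⟨-1, 1, by ring⟩
  have hdvd : (p : ℤ) ∣ m * (m + 1) := ⟨_, hmb⟩
  rcases hpZ.dvd_or_dvd hdvd with h | h
  -- If p divides m, then m = p s² and m + 1 = t², so (|t|, s) solves the Pell equation with 1 < |t|
  -- < X, against minimality. In the other case m + 1 = p s² and m = t² is the solution sought.
  · exfalso
    obtain ⟨s, t, hs, ht⟩ := exists_sq_of_mul_eq_mul_sq hp0 hm.le (by omega) hcop hmb h
    have hst : |t| ^ 2 - p * s ^ 2 = 1 := by rw [sq_abs]; linarith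
    have ht0 : 0 ≤ |t| := abs_nonneg t
    have ht2 : |t| ^ 2 = m + 1 := by rw [sq_abs]; omega
    have ht1 : 1 < |t| := by nlinarith
    have := @hmin (Pell.Solution₁.mk |t| s hst) (by simpa using ht1)
    simp only [Pell.Solution₁.x_mk] at this
    nlinarith
  · obtain ⟨s, t, hs, ht⟩ := exists_sq_of_mul_eq_mul_sq hp0 (by omega) hm.le hcop.symm
      (by rw [mul_comm]; exact hmb) h
    exact ⟨t, s, by rw [← ht, hs]⟩

open GaussianInt in
/-- A prime `p ≡ 1 [MOD 4]` splits in `ℤ[i]` as `π π̄`, in such a way that some Gaussian integer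
`x + i` of norm `p y²` equals `π` up to units and squares. -/
theorem exists_gaussian_prime {p : ℕ} (hp : p.Prime) (hp4 : p ≡ 1 [MOD 4]) :
    ∃ (x y : ℤ) (π z u : GaussianInt), x ^ 2 + 1 = p * y ^ 2 ∧ Prime π ∧ Prime (star π) ∧
      ¬ Associated π (star π) ∧ π * star π = p ∧ IsUnit u ∧
      (⟨x, 1⟩ : GaussianInt) = u * π * z ^ 2 := by
  have : Fact p.Prime := ⟨hp⟩
  have hp4' : p % 4 = 1 := hp4
  obtain ⟨x, y, hxy⟩ := exists_sq_add_one_eq_prime_mul_sq hp hp4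
  have hnp : ¬ Irreducible (p : GaussianInt) := by
    intro h
    have := (prime_iff_mod_four_eq_three_of_nat_prime p).mp h.prime
    omega
  obtain ⟨a, b, hab⟩ := sq_add_sq_of_nat_prime_of_not_irreducible p hnp
  have hprime : ∀ w : GaussianInt, w * star w = p → Prime w := by
    intro w hw
    have hwn : w.norm = p := by
      have h := Zsqrtd.norm_eq_mul_conj w
      rw [hw] at h
      exact_mod_cast h
    refine Irreducible.prime ⟨fun h => ?_, fun s t hst => ?_⟩
    · rw [← Zsqrtd.norm_eq_one_iff, hwn, Int.natAbs_natCast] at h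
      exact hp.one_lt.ne' h
    · have h : s.norm.natAbs * t.norm.natAbs = p := by
        rw [← Int.natAbs_mul, ← Zsqrtd.norm_mul, ← hst, hwn, Int.natAbs_natCast]
      rw [← Zsqrtd.norm_eq_one_iff, ← Zsqrtd.norm_eq_one_iff]
      rcases (Nat.dvd_prime hp).mp (Dvd.intro _ h) with h1 | h1
      · exact Or.inl h1
      · right
        rw [h1] at h
        exact Nat.eq_of_mul_eq_mul_left hp.pos (h.trans (mul_one p).symm)
  -- For odd x, x² + 1 ≡ 2 mod 4, whereas p y² ≡ y² is 0 or 1. Evenness is what makes x + i and x -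
  -- i coprime.
  have hx2 : x % 2 = 0 := by
    by_contra hodd
    have h1 : x ^ 2 % 4 = 1 := by
      have : x % 4 = 1 ∨ x % 4 = 3 := by omega
      rcases this with h | h <;> simp [Int.mul_emod, pow_two, h]
    have h2 : (p * y ^ 2) % 4 = y ^ 2 % 4 := by
      rw [Int.mul_emod, show (p : ℤ) % 4 = 1 by omega]
      simp
    have h3 : y ^ 2 % 4 = 0 ∨ y ^ 2 % 4 = 1 := by
      have : y % 4 = 0 ∨ y % 4 = 1 ∨ y % 4 = 2 ∨ y % 4 = 3 := by omega
      rcases this with h | h | h | h <;> simp [Int.mul_emod, pow_two, h]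
    omega
  obtain ⟨m, rfl⟩ : ∃ m, x = 2 * m := ⟨x / 2, by omega⟩
  have hcop : IsCoprime (⟨2 * m, 1⟩ : GaussianInt) (⟨2 * m, -1⟩ : GaussianInt) := by
    -- Here (2m - i)(2m + i) = 4m² + 1, and 2m²i times the difference 2i of the two numbers is -4m².
    refine ⟨⟨2 * m, -1⟩ + ⟨0, 2 * m ^ 2⟩, -⟨0, 2 * m ^ 2⟩, ?_⟩
    ext <;> simp <;> ring
  have hstar : star (⟨2 * m, 1⟩ : GaussianInt) = ⟨2 * m, -1⟩ := rfl
  have hN : (⟨2 * m, 1⟩ : GaussianInt) * ⟨2 * m, -1⟩ = p * (y : GaussianInt) ^ 2 := by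
    rw [← hstar, ← Zsqrtd.norm_eq_mul_conj, ← Int.cast_natCast, ← Int.cast_pow, ← Int.cast_mul,
      ← hxy, Zsqrtd.norm_def]
    congr 1
    ring
  obtain ⟨π, hπ, hdvd⟩ : ∃ π : GaussianInt, π * star π = p ∧ π ∣ (⟨2 * m, 1⟩ : GaussianInt) := by
    have h0 : (⟨a, b⟩ : GaussianInt) * star (⟨a, b⟩ : GaussianInt) = p := by
      rw [← Zsqrtd.norm_eq_mul_conj, ← Int.cast_natCast, ← hab, Zsqrtd.norm_def]
      congr 1
      push_cast
      ring
    have h1 : (⟨a, b⟩ : GaussianInt) ∣ ⟨2 * m, 1⟩ * ⟨2 * m, -1⟩ := by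
      rw [hN, ← h0, mul_assoc]
      exact Dvd.intro _ rfl
    rcases (hprime _ h0).dvd_or_dvd h1 with h | h
    · exact ⟨_, h0, h⟩
    · refine ⟨star ⟨a, b⟩, by rw [star_star, mul_comm]; exact h0, ?_⟩
      obtain ⟨c, hc⟩ := h
      refine ⟨star c, ?_⟩
      rw [← star_mul', ← hc]
      rfl
  have hπ' : star π * star (star π) = p := by rw [star_star, mul_comm]; exact hπ
  obtain ⟨w, hw⟩ := hdvd
  have hw' : (⟨2 * m, -1⟩ : GaussianInt) = star π * star w := by rw [← hstar, hw, star_mul']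
  have hp0 : (p : GaussianInt) ≠ 0 := Nat.cast_ne_zero.mpr hp.ne_zero
  have hww : w * star w = (y : GaussianInt) ^ 2 := by
    apply mul_left_cancel₀ hp0
    rw [← hN, hw', hw, ← hπ]
    ring
  -- The cofactor w = (x + i)/π is coprime to its conjugate and their product is y², so w is a
  -- square up to a unit.
  have hcopw : IsCoprime w (star w) := by
    rw [hw, hw'] at hcop
    exact (hcop.of_mul_left_right).of_mul_right_right
  obtain ⟨z, v, hv⟩ := exists_associated_pow_of_mul_eq_pow' hcopw hww
  refine ⟨2 * m, y, π, z, v, hxy, hprime π hπ, hprime _ hπ', ?_, hπ, v.isUnit, ?_⟩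
  · intro h
    have h1 : star π ∣ (⟨2 * m, 1⟩ : GaussianInt) := by
      rw [hw]
      exact h.symm.dvd.mul_right w
    have h2 : star π ∣ (⟨2 * m, -1⟩ : GaussianInt) := by
      rw [hw']
      exact Dvd.intro _ rfl
    exact (hprime _ hπ').not_isUnit (hcop.isUnit_of_dvd' h1 h2)
  · rw [hw, ← hv]
    ring

/-! ### Products of distinct primes modulo units and squares -/

section UniqueFactorization

variable {D ι : Type*} [CommRing D] [IsDomain D] [WfDvdMonoid D] {ϖ : ι → D}

theorem multiplicity_prod_primes [DecidableEq ι] (hϖ : ∀ j, Prime (ϖ j))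
    (hna : ∀ i j, i ≠ j → ¬ Associated (ϖ i) (ϖ j)) (S : Finset ι) (j : ι) :
    emultiplicity (ϖ j) (∏ i ∈ S, ϖ i) = if j ∈ S then 1 else 0 := by
  rw [Finset.emultiplicity_prod (hϖ j)]
  have h : ∀ i ∈ S, emultiplicity (ϖ j) (ϖ i) = if j = i then 1 else 0 := by
    intro i _
    split_ifs with hij
    · subst hij
      exact (FiniteMultiplicity.of_prime_left (hϖ j) (hϖ j).ne_zero).emultiplicity_self
    · exact emultiplicity_eq_zero.mpr fun hd => hna j i hij ((hϖ j).associated_of_dvd (hϖ i) hd)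
  rw [Finset.sum_congr rfl h, Finset.sum_ite_eq]

/-- The products over two sets of pairwise nonassociated primes agree up to units and squares
only if the sets coincide. -/
theorem eq_of_sq_mul_prod_eq (hϖ : ∀ j, Prime (ϖ j))
    (hna : ∀ i j, i ≠ j → ¬ Associated (ϖ i) (ϖ j)) {S T : Finset ι} {b c w : D}
    (hb : b ≠ 0) (hc : c ≠ 0) (hw : IsUnit w)
    (h : b ^ 2 * (∏ j ∈ T, ϖ j) * w = c ^ 2 * ∏ j ∈ S, ϖ j) : S = T := by
  classical
  ext j
  have hfb := FiniteMultiplicity.of_prime_left (hϖ j) hb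
  have hfc := FiniteMultiplicity.of_prime_left (hϖ j) hc
  have hw0 : emultiplicity (ϖ j) w = 0 :=
    emultiplicity_eq_zero.mpr fun hd => (hϖ j).not_isUnit (isUnit_of_dvd_unit hd hw)
  have h' := congrArg (emultiplicity (ϖ j)) h
  rw [emultiplicity_mul (hϖ j), emultiplicity_mul (hϖ j), emultiplicity_mul (hϖ j),
    emultiplicity_pow (hϖ j), emultiplicity_pow (hϖ j), multiplicity_prod_primes hϖ hna,
    multiplicity_prod_primes hϖ hna, hw0, hfb.emultiplicity_eq_multiplicity,
    hfc.emultiplicity_eq_multiplicity, add_zero] at h'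
  by_cases hS : j ∈ S <;> by_cases hT : j ∈ T <;> simp only [hS, hT, if_true, if_false] at h' ⊢
  all_goals
    exfalso
    norm_cast at h'
    omega

end UniqueFactorization

/-! ### Index of the squares in unit groups -/

section GroupIndex

/-- A subgroup `B` of finite index of a commutative group `A` satisfies `[B : B²] ≤ [A : A²]`. -/
theorem relIndex_map_pow_le_index {A : Type*} [CommGroup A] (n : ℕ) (B : Subgroup A)
    (hB : B.index ≠ 0) (hA : (powMonoidHom n : A →* A).range.index ≠ 0) :
    (B.map (powMonoidHom n)).relIndex B ≠ 0 ∧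
      (B.map (powMonoidHom n)).relIndex B ≤ (powMonoidHom n : A →* A).range.index := by
  set f : A →* A := powMonoidHom n with hf
  have hle : B.map f ≤ B := by
    rintro _ ⟨b, hb, rfl⟩
    exact B.pow_mem hb n
  have hle' : B.map f ≤ f.range := by
    rintro _ ⟨b, -, rfl⟩
    exact ⟨b, rfl⟩
  -- The index [A : Bⁿ] is computed through B and through Aⁿ; the power map induces a surjection A/B
  -- → Aⁿ/Bⁿ, so [Aⁿ : Bⁿ] divides [A : B].
  have h1 := Subgroup.relIndex_mul_index hle
  have h2 := Subgroup.relIndex_mul_index hle'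
  have h3 : (B.map f).relIndex f.range ∣ B.index := by
    rw [MonoidHom.range_eq_map, Subgroup.relIndex_map_map, top_sup_eq, Subgroup.relIndex_top_right]
    exact Subgroup.index_dvd_of_le le_sup_left
  have h4 : (B.map f).relIndex f.range ≤ B.index := Nat.le_of_dvd (Nat.pos_of_ne_zero hB) h3
  have h5 : (B.map f).relIndex f.range ≠ 0 := fun h => hB (Nat.eq_zero_of_zero_dvd (h ▸ h3))
  rw [← h2] at h1
  constructor
  · intro h
    rw [h, zero_mul] at h1
    exact mul_ne_zero h5 hA h1.symm
  · by_contra! hlt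
    have := Nat.mul_lt_mul_of_le_of_lt h4 hlt (Nat.pos_of_ne_zero hB)
    rw [mul_comm B.index] at this
    omega

end GroupIndex

section Units

variable (k : Type*) [Field k] [NumberField k]

open NumberField NumberField.Units in
/-- If the unit group of a number field has rank at most one, its squares have index at most
four. -/
theorem index_sq_units_le (hr : rank k ≤ 1) :
    (powMonoidHom 2 : (𝓞 k)ˣ →* (𝓞 k)ˣ).range.index ≠ 0 ∧
      (powMonoidHom 2 : (𝓞 k)ˣ →* (𝓞 k)ˣ).range.index ≤ 4 := by
  obtain ⟨ζ, hζ⟩ := IsCyclic.exists_generator (α := torsion k)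
  -- The product has at most one factor: η is the fundamental unit, or 1 when the rank is zero.
  let η : (𝓞 k)ˣ := ∏ i, fundSystem k i
  have hsub : Subsingleton (Fin (rank k)) := Fin.subsingleton_iff_le_one.mpr hr
  have hgen : ∀ x : (𝓞 k)ˣ, ∃ m n : ℤ, x = (ζ : (𝓞 k)ˣ) ^ m * η ^ n := by
    intro x
    obtain ⟨⟨ξ, e⟩, hx, -⟩ := exist_unique_eq_mul_prod k x
    obtain ⟨m, hm⟩ := hζ ξ
    obtain ⟨n, hn⟩ : ∃ n : ℤ, ∏ i, fundSystem k i ^ e i = η ^ n := by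
      rcases isEmpty_or_nonempty (Fin (rank k)) with h | ⟨⟨i⟩⟩
      · exact ⟨0, by simp⟩
      · refine ⟨e i, ?_⟩
        rw [Fintype.prod_subsingleton _ i, show η = fundSystem k i from
          Fintype.prod_subsingleton _ i]
    refine ⟨m, n, ?_⟩
    rw [hx, ← hn, ← hm]
    simp
  let g : Fin 2 × Fin 2 → (𝓞 k)ˣ ⧸ (powMonoidHom 2 : (𝓞 k)ˣ →* (𝓞 k)ˣ).range := fun ab =>
    QuotientGroup.mk ((ζ : (𝓞 k)ˣ) ^ (ab.1 : ℕ) * η ^ (ab.2 : ℕ))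
  have hg : Function.Surjective g := by
    intro x
    obtain ⟨x, rfl⟩ := QuotientGroup.mk_surjective x
    obtain ⟨m, n, rfl⟩ := hgen x
    have red : ∀ m : ℤ, ∃ (a : Fin 2) (s : ℤ), m = a + 2 * s := by
      intro m
      refine ⟨⟨(m % 2).toNat, by omega⟩, m / 2, ?_⟩
      simp only
      omega
    obtain ⟨a, s, rfl⟩ := red m
    obtain ⟨b, t, rfl⟩ := red n
    refine ⟨(a, b), ?_⟩
    refine QuotientGroup.eq.mpr ⟨(ζ : (𝓞 k)ˣ) ^ s * η ^ t, ?_⟩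
    simp only [powMonoidHom_apply, zpow_add, zpow_natCast, zpow_mul, zpow_ofNat]
    have : ∀ A B : (𝓞 k)ˣ, (A ^ s * B ^ t) ^ 2 = (A ^ 2) ^ s * (B ^ 2) ^ t := by
      intro A B
      rw [mul_pow, ← zpow_natCast, ← zpow_natCast, ← zpow_natCast, ← zpow_natCast, ← zpow_mul,
        ← zpow_mul, ← zpow_mul, ← zpow_mul, mul_comm s, mul_comm t]
    rw [this, eq_inv_mul_iff_mul_eq]
    exact mul_mul_mul_comm _ _ _ _
  have hfin := Finite.of_surjective g hg
  constructor
  · exact Subgroup.index_ne_zero_of_finite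
  · exact (Nat.card_le_card_of_surjective g hg).trans (by simp)

end Units

/-! ### Ramified primes and ambiguous classes in a quadratic extension -/

section Galois

variable {F k : Type*} [Field F] [Field k] [Algebra F k]

theorem exists_unit_of_isIntegral {x : k} (hx : IsIntegral ℤ x) (hx' : IsIntegral ℤ x⁻¹)
    (h0 : x ≠ 0) : ∃ u : (𝓞 k)ˣ, ((u : 𝓞 k) : k) = x :=
  ⟨⟨⟨x, hx⟩, ⟨x⁻¹, hx'⟩, by ext; exact mul_inv_cancel₀ h0, by ext; exact inv_mul_cancel₀ h0⟩, rfl⟩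

theorem isIntegral_coe_unit_inv (u : (𝓞 k)ˣ) : IsIntegral ℤ (((u : 𝓞 k) : k)⁻¹) := by
  have : ((u : 𝓞 k) : k)⁻¹ = ((u⁻¹ : (𝓞 k)ˣ) : 𝓞 k) := by
    refine inv_eq_of_mul_eq_one_right ?_
    rw [← map_mul, Units.mul_inv, map_one]
  rw [this]
  exact NumberField.RingOfIntegers.isIntegral_coe _

/-- If `α² = u r` with `u` a unit and `r` in the base field, then `σ(α) / α` is a unit. -/
theorem exists_unit_eq_conj_div (σ : Gal(k/F)) {α : k} (hα : α ≠ 0) (u : (𝓞 k)ˣ) (r : F)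
    (h : α ^ 2 = ((u : 𝓞 k) : k) * algebraMap F k r) :
    ∃ ε : (𝓞 k)ˣ, ((ε : 𝓞 k) : k) = σ α / α := by
  have hr : algebraMap F k r ≠ 0 := by
    intro h0
    rw [h0, mul_zero] at h
    exact hα (pow_eq_zero_iff two_ne_zero |>.mp h)
  have hσ : (σ α) ^ 2 = σ ((u : 𝓞 k) : k) * algebraMap F k r := by
    rw [← map_pow, h, map_mul, AlgEquiv.commutes]
  have hint : ∀ v : (𝓞 k)ˣ, IsIntegral ℤ (σ ((v : 𝓞 k) : k)) := fun v =>
    (NumberField.RingOfIntegers.isIntegral_coe (v : 𝓞 k)).map (σ.toRingEquiv.toRingHom.toIntAlgHom)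
  have hint' : IsIntegral ℤ (σ ((u : 𝓞 k) : k))⁻¹ := by
    rw [← map_inv₀]
    exact (isIntegral_coe_unit_inv u).map (σ.toRingEquiv.toRingHom.toIntAlgHom)
  -- The factor r cancels in (σ(α)/α)² = σ(u)/u, which is a unit; integrality passes to the square
  -- root.
  apply exists_unit_of_isIntegral
  · refine IsIntegral.of_pow two_pos ?_
    rw [div_pow, h, hσ, mul_div_mul_right _ _ hr, div_eq_mul_inv]
    exact (hint u).mul (isIntegral_coe_unit_inv u)
  · refine IsIntegral.of_pow two_pos ?_
    rw [inv_div, div_pow, h, hσ, mul_div_mul_right _ _ hr, div_eq_mul_inv]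
    exact (NumberField.RingOfIntegers.isIntegral_coe _).mul hint'
  · exact div_ne_zero (by simpa using hα) hα

end Galois

section

variable {F k : Type*} [Field F] [Field k] [NumberField k] [Algebra F k]

/-- If two products of ideals `P_j` with `P_j² = (ϖ_j)` lie in the same class, then the quotient
of the products of the `ϖ_j` is, up to units, a square. -/
theorem exists_sq_mul_prod_eq_of_mk0_eq {ι : Type*} {ϖ : ι → 𝓞 F}
    {P : ι → (Ideal (𝓞 k))⁰}
    (hP : ∀ j, (P j : Ideal (𝓞 k)) ^ 2 = Ideal.span {algebraMap (𝓞 F) (𝓞 k) (ϖ j)})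
    {S T : Finset ι} (h : ClassGroup.mk0 (∏ j ∈ S, P j) = ClassGroup.mk0 (∏ j ∈ T, P j)) :
    ∃ (α : k) (u : (𝓞 k)ˣ), α ≠ 0 ∧
      α ^ 2 * algebraMap F k ((∏ j ∈ T, ϖ j : 𝓞 F) : F) =
        ((u : 𝓞 k) : k) * algebraMap F k ((∏ j ∈ S, ϖ j : 𝓞 F) : F) := by
  have hsq : ∀ U : Finset ι, ((∏ j ∈ U, P j : (Ideal (𝓞 k))⁰) : Ideal (𝓞 k)) ^ 2 =
      Ideal.span {algebraMap (𝓞 F) (𝓞 k) (∏ j ∈ U, ϖ j)} := by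
    intro U
    rw [Submonoid.coe_finsetProd, ← Finset.prod_pow, Finset.prod_congr rfl fun j _ => hP j,
      Ideal.prod_span_singleton, map_prod]
  obtain ⟨x, y, hx, hy, hxy⟩ := ClassGroup.mk0_eq_mk0_iff.mp h
  have h2 := congrArg (· ^ 2) hxy
  simp only [mul_pow, hsq, Ideal.span_singleton_pow, Ideal.span_singleton_mul_span_singleton] at h2
  obtain ⟨u, hu⟩ := Ideal.span_singleton_eq_span_singleton.mp h2
  have hx' : (x : k) ≠ 0 := by rwa [NumberField.RingOfIntegers.coe_ne_zero_iff]
  have hy' : (y : k) ≠ 0 := by rwa [NumberField.RingOfIntegers.coe_ne_zero_iff]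
  refine ⟨(y : k) / x, u, div_ne_zero hy' hx', ?_⟩
  have h3 := congrArg (algebraMap (𝓞 k) k) hu
  simp only [map_mul, map_pow, ← IsScalarTower.algebraMap_apply (𝓞 F) (𝓞 k) k,
    IsScalarTower.algebraMap_apply (𝓞 F) F k] at h3
  field_simp
  linear_combination -h3

end

section

variable {F k : Type*} [Field F] [NumberField F] [Field k] [Algebra F k]

/-- A square `β²` of an element of `F` which is a unit of `k` times a quotient of products of
nonassociated primes of `F` determines these products. -/
theorem eq_of_sq_mul_prod_eq_unit_mul [WfDvdMonoid (𝓞 F)] {ι : Type*} {ϖ : ι → 𝓞 F}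
    (hϖ : ∀ j, Prime (ϖ j)) (hna : ∀ i j, i ≠ j → ¬ Associated (ϖ i) (ϖ j)) {S T : Finset ι}
    {β : F} (hβ : β ≠ 0) (w : (𝓞 k)ˣ)
    (h : algebraMap F k (β ^ 2 * ((∏ j ∈ T, ϖ j : 𝓞 F) : F)) * ((w : 𝓞 k) : k) =
      algebraMap F k ((∏ j ∈ S, ϖ j : 𝓞 F) : F)) : S = T := by
  have hne : ∀ U : Finset ι, ((∏ j ∈ U, ϖ j : 𝓞 F) : F) ≠ 0 := fun U => by
    rw [NumberField.RingOfIntegers.coe_ne_zero_iff]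
    exact Finset.prod_ne_zero_iff.mpr fun j _ => (hϖ j).ne_zero
  set s := ((∏ j ∈ S, ϖ j : 𝓞 F) : F) with hs
  set t := ((∏ j ∈ T, ϖ j : 𝓞 F) : F) with ht
  have hβt : β ^ 2 * t ≠ 0 := mul_ne_zero (pow_ne_zero 2 hβ) (hne T)
  have hw : algebraMap F k (s / (β ^ 2 * t)) = ((w : 𝓞 k) : k) := by
    rw [map_div₀, ← h, mul_div_cancel_left₀]
    simpa using hβt
  have hw' : algebraMap F k (s / (β ^ 2 * t))⁻¹ = ((w : 𝓞 k) : k)⁻¹ := by rw [map_inv₀, hw]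
  have hinj : Function.Injective (algebraMap F k) := (algebraMap F k).injective
  have hint : IsIntegral ℤ (s / (β ^ 2 * t)) := by
    rw [← isIntegral_algebraMap_iff (B := k) hinj, hw]
    exact NumberField.RingOfIntegers.isIntegral_coe _
  have hint' : IsIntegral ℤ (s / (β ^ 2 * t))⁻¹ := by
    rw [← isIntegral_algebraMap_iff (B := k) hinj, hw']
    exact isIntegral_coe_unit_inv w
  -- The unit w of k lies in F, hence is a unit of F; the rest is unique factorization after writing
  -- β = b/c.
  obtain ⟨v, hv⟩ := exists_unit_of_isIntegral hint hint' (div_ne_zero (hne S) hβt)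
  obtain ⟨b, c, hc, rfl⟩ := IsFractionRing.div_surjective (A := 𝓞 F) β
  have hc0 : c ≠ 0 := nonZeroDivisors.ne_zero hc
  have hb0 : b ≠ 0 := by
    rintro rfl
    simp at hβ
  refine eq_of_sq_mul_prod_eq hϖ hna hb0 hc0 v.isUnit ?_
  apply NumberField.RingOfIntegers.coe_injective
  rw [map_mul, map_mul, map_mul, map_pow, map_pow]
  change (b : F) ^ 2 * t * ((v : 𝓞 F) : F) = (c : F) ^ 2 * s
  rw [hv]
  have : (c : F) ≠ 0 := by rwa [NumberField.RingOfIntegers.coe_ne_zero_iff]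
  have h2 : (b : F) ≠ 0 := by rwa [NumberField.RingOfIntegers.coe_ne_zero_iff]
  have h3 : t ≠ 0 := hne T
  field_simp

end

section Quadratic

variable {F k : Type*} [Field F] [NumberField F] [Field k] [NumberField k] [Algebra F k]
  [IsGalois F k]

theorem algebraMap_norm_eq_mul_conj (σ : Gal(k/F)) (hσ1 : σ ≠ 1)
    (hσ : ∀ τ : Gal(k/F), τ = 1 ∨ τ = σ) (x : k) :
    algebraMap F k (Algebra.norm F x) = x * σ x := by
  classical
  rw [Algebra.norm_eq_prod_automorphisms]
  have : (Finset.univ : Finset Gal(k/F)) = {1, σ} := by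
    ext τ
    simpa using hσ τ
  rw [this, Finset.prod_pair hσ1.symm]
  rfl

theorem exists_eq_algebraMap_of_conj_eq (σ : Gal(k/F)) (hσ : ∀ τ : Gal(k/F), τ = 1 ∨ τ = σ)
    {x : k} (hx : σ x = x) : ∃ y : F, algebraMap F k y = x := by
  have : x ∈ (⊥ : IntermediateField F k) := by
    rw [IsGalois.mem_bot_iff_fixed]
    intro τ
    rcases hσ τ with rfl | rfl
    · rfl
    · exact hx
  exact IntermediateField.mem_bot.mp this

/-- Among the products of `n` ramified primes of a quadratic extension `k/F`, each ideal class
occurs at most four times, when the squares have index at most four in the unit group. -/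
theorem card_fiber_le_four [WfDvdMonoid (𝓞 F)] [Finite (𝓞 F)ˣ] (hr : NumberField.Units.rank k ≤ 1)
    (σ : Gal(k/F)) (hσ1 : σ ≠ 1) (hσ : ∀ τ : Gal(k/F), τ = 1 ∨ τ = σ)
    {ι : Type*} [Fintype ι] [DecidableEq (ClassGroup (𝓞 k))] {ϖ : ι → 𝓞 F}
    (hϖ : ∀ j, Prime (ϖ j)) (hna : ∀ i j, i ≠ j → ¬ Associated (ϖ i) (ϖ j))
    {P : ι → (Ideal (𝓞 k))⁰}
    (hP : ∀ j, (P j : Ideal (𝓞 k)) ^ 2 = Ideal.span {algebraMap (𝓞 F) (𝓞 k) (ϖ j)})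
    (c : ClassGroup (𝓞 k)) :
    {S : Finset ι | ClassGroup.mk0 (∏ j ∈ S, P j) = c}.ncard ≤ 4 := by
  have hne : ∀ U : Finset ι, algebraMap F k ((∏ j ∈ U, ϖ j : 𝓞 F) : F) ≠ 0 := fun U => by
    rw [map_ne_zero_iff _ (algebraMap F k).injective, NumberField.RingOfIntegers.coe_ne_zero_iff]
    exact Finset.prod_ne_zero_iff.mpr fun j _ => (hϖ j).ne_zero
  by_cases hemp : ∃ T : Finset ι, ClassGroup.mk0 (∏ j ∈ T, P j) = c
  swap
  · have : {S : Finset ι | ClassGroup.mk0 (∏ j ∈ S, P j) = c} = ∅ := by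
      ext S
      simpa using fun h => hemp ⟨S, h⟩
    rw [this, Set.ncard_empty]
    exact Nat.zero_le 4
  obtain ⟨T, rfl⟩ := hemp
  have hσσ : ∀ x, σ (σ x) = x := by
    intro x
    rcases hσ (σ * σ) with h | h
    · exact DFunLike.congr_fun h x
    · exact absurd (mul_eq_left.mp h) hσ1
  let N : (𝓞 k)ˣ →* (𝓞 F)ˣ := Units.map (RingOfIntegers.norm F)
  have hN : ∀ ε : (𝓞 k)ˣ, ε ∈ N.ker ↔ ((ε : 𝓞 k) : k) * σ ((ε : 𝓞 k) : k) = 1 := by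
    intro ε
    rw [← algebraMap_norm_eq_mul_conj σ hσ1 hσ, MonoidHom.mem_ker, Units.ext_iff,
      ← NumberField.RingOfIntegers.coe_injective.eq_iff,
      ← (algebraMap F k).injective.eq_iff]
    simp [N]
  obtain ⟨hA, hA4⟩ := index_sq_units_le k hr
  -- The index of the norm-one units is the order of the image of N, finite because F has finitely
  -- many units.
  have hB : N.ker.index ≠ 0 := by
    rw [Subgroup.index_ker]
    exact Nat.card_pos.ne'
  obtain ⟨hq0, hq⟩ := relIndex_map_pow_le_index 2 N.ker hB hA
  choose! α u hα hαu using fun (S : Finset ι)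
    (hS : ClassGroup.mk0 (∏ j ∈ S, P j) = ClassGroup.mk0 (∏ j ∈ T, P j)) =>
      exists_sq_mul_prod_eq_of_mk0_eq hP hS
  have hε : ∀ S : Finset ι, ClassGroup.mk0 (∏ j ∈ S, P j) = ClassGroup.mk0 (∏ j ∈ T, P j) →
      ∃ ε : N.ker, (((ε : (𝓞 k)ˣ) : 𝓞 k) : k) = σ (α S) / α S := by
    intro S hS
    obtain ⟨ε, he⟩ := exists_unit_eq_conj_div σ (hα S hS) (u S)
      (((∏ j ∈ S, ϖ j : 𝓞 F) : F) / ((∏ j ∈ T, ϖ j : 𝓞 F) : F)) (by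
        rw [map_div₀, ← mul_div_assoc, eq_div_iff (hne T), hαu S hS])
    refine ⟨⟨ε, ?_⟩, he⟩
    have h1 := hα S hS
    have h2 : σ (α S) ≠ 0 := by simpa using h1
    rw [hN, he, map_div₀, hσσ]
    field_simp
  choose! ε hε using hε
  let g : Finset ι → N.ker ⧸ ((N.ker.map (powMonoidHom 2)).subgroupOf N.ker) :=
    fun S => QuotientGroup.mk (ε S)
  have hfin : Finite (N.ker ⧸ ((N.ker.map (powMonoidHom 2)).subgroupOf N.ker)) :=
    Nat.finite_of_card_ne_zero hq0
  have hinj : Set.InjOn g {S : Finset ι | ClassGroup.mk0 (∏ j ∈ S, P j) =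
      ClassGroup.mk0 (∏ j ∈ T, P j)} := by
    intro S hS U hU h
    obtain ⟨η, hη, hη2⟩ := QuotientGroup.eq.mp h
    rw [SetLike.mem_coe, hN] at hη
    have hη0 : ((η : 𝓞 k) : k) ≠ 0 := fun h0 => by simp [h0] at hη
    have hη3 : σ (α S) / α S * ((η : 𝓞 k) : k) ^ 2 = σ (α U) / α U := by
      rw [← hε S hS, ← hε U hU]
      have h' := congrArg (fun v : (𝓞 k)ˣ => ((v : 𝓞 k) : k)) hη2
      simp only [powMonoidHom_apply, Subgroup.subtype_apply, Units.val_pow_eq_pow_val, map_pow] at h'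
      rw [h', ← map_mul, ← Units.val_mul]
      simp
    have hS0 := hα S hS
    have hU0 := hα U hU
    have hσS : σ (α S) ≠ 0 := by simpa using hS0
    have hσU : σ (α U) ≠ 0 := by simpa using hU0
    have hση : σ ((η : 𝓞 k) : k) = ((η : 𝓞 k) : k)⁻¹ := eq_inv_of_mul_eq_one_right hη
    -- From ε_U = ε_S η² and σ(η) = η⁻¹, the element α_U η / α_S is fixed by σ. It thus lies in F,
    -- and comparing squares there forces U = S.
    obtain ⟨β, hβ⟩ := exists_eq_algebraMap_of_conj_eq σ hσ
      (x := α U * ((η : 𝓞 k) : k) / α S) (by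
        rw [map_div₀, map_mul, hση]
        field_simp at hη3 ⊢
        linear_combination -hη3)
    have hβ0 : β ≠ 0 := by
      rintro rfl
      rw [map_zero] at hβ
      exact div_ne_zero (mul_ne_zero hU0 hη0) hS0 hβ.symm
    refine (eq_of_sq_mul_prod_eq_unit_mul hϖ hna hβ0 (u S / (η ^ 2 * u U)) ?_).symm
    have hunit : (((u S / (η ^ 2 * u U) : (𝓞 k)ˣ) : 𝓞 k) : k) *
        (((η : 𝓞 k) : k) ^ 2 * ((u U : 𝓞 k) : k)) = ((u S : 𝓞 k) : k) := by
      rw [← map_pow, ← map_mul, ← map_mul, ← Units.val_pow_eq_pow_val, ← Units.val_mul,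
        ← Units.val_mul, div_mul_cancel]
    have hS1 := hαu S hS
    have hU1 := hαu U hU
    have huU : ((u U : 𝓞 k) : k) ≠ 0 := by simp
    apply mul_left_cancel₀ (mul_ne_zero (pow_ne_zero 2 hS0) huU)
    generalize (((u S / (η ^ 2 * u U) : (𝓞 k)ˣ) : 𝓞 k) : k) = w at *
    have hb : algebraMap F k β * α S = α U * ((η : 𝓞 k) : k) := by
      rw [hβ, div_mul_cancel₀ _ hS0]
    rw [map_mul, map_pow]
    generalize algebraMap F k ((∏ j ∈ S, ϖ j : 𝓞 F) : F) = πS at *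
    generalize algebraMap F k ((∏ j ∈ U, ϖ j : 𝓞 F) : F) = πU at *
    generalize algebraMap F k ((∏ j ∈ T, ϖ j : 𝓞 F) : F) = πT at *
    linear_combination (πS * w * ((u U : 𝓞 k) : k)) *
      (algebraMap F k β * α S + α U * ((η : 𝓞 k) : k)) * hb + α U ^ 2 * πS * hunit +
      α S ^ 2 * hU1 - α U ^ 2 * hS1
  calc _ ≤ (Set.univ : Set (N.ker ⧸ ((N.ker.map (powMonoidHom 2)).subgroupOf N.ker))).ncard :=
        Set.ncard_le_ncard_of_injOn g (fun _ _ => Set.mem_univ _) hinj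
    _ ≤ 4 := by
        rw [Set.ncard_univ]
        exact hq.trans hA4

/-- Pigeonhole on the subsets of the index set, with fibres of size at most four. -/
theorem card_le_four_mul_card_range [WfDvdMonoid (𝓞 F)] [Finite (𝓞 F)ˣ]
    (hr : NumberField.Units.rank k ≤ 1)
    (σ : Gal(k/F)) (hσ1 : σ ≠ 1) (hσ : ∀ τ : Gal(k/F), τ = 1 ∨ τ = σ)
    {ι : Type*} [Fintype ι] {ϖ : ι → 𝓞 F}
    (hϖ : ∀ j, Prime (ϖ j)) (hna : ∀ i j, i ≠ j → ¬ Associated (ϖ i) (ϖ j))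
    {P : ι → (Ideal (𝓞 k))⁰}
    (hP : ∀ j, (P j : Ideal (𝓞 k)) ^ 2 = Ideal.span {algebraMap (𝓞 F) (𝓞 k) (ϖ j)}) :
    2 ^ Fintype.card ι ≤
      4 * (Set.range fun S : Finset ι => ClassGroup.mk0 (∏ j ∈ S, P j)).ncard := by
  classical
  have h := Finset.card_le_mul_card_image (f := fun S : Finset ι => ClassGroup.mk0 (∏ j ∈ S, P j))
    (Finset.univ : Finset (Finset ι)) 4 (by
      intro c _
      have := card_fiber_le_four hr σ hσ1 hσ hϖ hna hP c
      rwa [Set.ncard_eq_toFinset_card', Set.toFinset_ofPred] at this)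
  rw [Finset.card_univ, Fintype.card_finset] at h
  rwa [← Set.image_univ, ← Finset.coe_univ, ← Finset.coe_image, Set.ncard_coe_finset]

/-- In a quadratic extension of a field of class number one, the conjugate of an ideal class is
its inverse. -/
theorem exists_mul_smul_eq_span [IsPrincipalIdealRing (𝓞 F)]
    (σ : Gal(k/F)) (hσ1 : σ ≠ 1) (hσ : ∀ τ : Gal(k/F), τ = 1 ∨ τ = σ)
    (I : Ideal (𝓞 k)) : ∃ x : 𝓞 k, I * σ • I = Ideal.span {x} := by
  rcases eq_or_ne I ⊥ with rfl | hI
  · exact ⟨0, by simp⟩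
  have hcoe : ∀ x : 𝓞 k, algebraMap (𝓞 F) (𝓞 k) (Algebra.intNorm (𝓞 F) (𝓞 k) x) = x * σ • x := by
    intro x
    apply NumberField.RingOfIntegers.coe_injective
    rw [map_mul, ← IsScalarTower.algebraMap_apply (𝓞 F) (𝓞 k) k,
      IsScalarTower.algebraMap_apply (𝓞 F) F k, Algebra.algebraMap_intNorm (L := k),
      algebraMap_norm_eq_mul_conj σ hσ1 hσ]
    rfl
  have hle : (Ideal.relNorm (𝓞 F) I).map (algebraMap (𝓞 F) (𝓞 k)) ≤ I * σ • I := by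
    rw [Ideal.map_relNorm, Ideal.span_le]
    rintro _ ⟨x, hx, rfl⟩
    rw [Function.comp_apply, hcoe]
    exact Ideal.mul_mem_mul hx (Ideal.smul_mem_pointwise_smul _ _ _ hx)
  obtain ⟨C, hC⟩ := Ideal.dvd_iff_le.mpr hle
  have hn : Ideal.relNorm (𝓞 F) I ≠ 0 := by
    rw [Ideal.zero_eq_bot, Ne, Ideal.relNorm_eq_bot_iff]
    exact hI
  have hfr : Module.finrank F k = 2 := by
    rw [← IsGalois.card_aut_eq_finrank, ← Set.ncard_univ,
      show (Set.univ : Set Gal(k/F)) = {1, σ} from (Set.eq_univ_of_forall fun τ => hσ τ).symm,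
      Set.ncard_pair hσ1.symm]
  have hfr' : Module.finrank (𝓞 F) (𝓞 k) = 2 := by
    rw [← hfr]
    exact (IsFractionRing.finrank_eq (𝓞 F) F (𝓞 k) k).symm
  -- Both the extension of N(I) and I · σ(I) have relative norm N(I)², so the cofactor C has norm 1
  -- and is trivial.
  have h2 := congrArg (Ideal.relNorm (𝓞 F)) hC
  rw [map_mul, map_mul, Ideal.relNorm_smul, Ideal.relNorm_algebraMap,
    hfr', ← sq] at h2
  have h3 := mul_left_cancel₀ (pow_ne_zero 2 hn) (h2.symm.trans (mul_one _).symm)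
  have hCtop : C = ⊤ := by
    rw [Ideal.eq_top_iff_one]
    have h1 : (1 : 𝓞 F) ∈ Ideal.relNorm (𝓞 F) C := by
      rw [h3, Ideal.one_eq_top]
      exact Submodule.mem_top
    simpa using Ideal.relNorm_le_comap (𝓞 F) C h1
  obtain ⟨a, ha⟩ := IsPrincipalIdealRing.principal (Ideal.relNorm (𝓞 F) I)
  refine ⟨algebraMap (𝓞 F) (𝓞 k) a, ?_⟩
  rw [hCtop, Ideal.mul_top] at hC
  rw [← hC, ha, Ideal.submodule_span_eq, Ideal.map_span, Set.image_singleton]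

/-- Every ambiguous class of a quadratic extension of a field of class number one has order
dividing two. -/
theorem sq_eq_one_of_mem_ambiguousClasses [IsPrincipalIdealRing (𝓞 F)]
    (σ : Gal(k/F)) (hσ1 : σ ≠ 1) (hσ : ∀ τ : Gal(k/F), τ = 1 ∨ τ = σ)
    {c : ClassGroup (𝓞 k)} (hc : c ∈ ambiguousClasses F k) : c ^ 2 = 1 := by
  obtain ⟨I, rfl⟩ := ClassGroup.mk0_surjective c
  have h := hc σ
  rw [conjClass_mk0] at h
  obtain ⟨x, hx⟩ := exists_mul_smul_eq_span σ hσ1 hσ (I : Ideal (𝓞 k))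
  rw [sq]
  nth_rewrite 2 [← h]
  rw [← map_mul, ClassGroup.mk0_eq_one_iff]
  exact ⟨x, hx⟩

end Quadratic

/-! ### Adjoining square roots -/

section SquareRoots

open IntermediateField Polynomial

variable {K L : Type*} [Field K] [Field L] [Algebra K L]

theorem isIntegral_of_sq_eq {c : K} {x : L} (hx : x ^ 2 = algebraMap K L c) : IsIntegral K x :=
  IsIntegral.of_pow two_pos (hx ▸ isIntegral_algebraMap)

theorem finrank_adjoin_sqrt_le {c : K} {x : L} (hx : x ^ 2 = algebraMap K L c) :
    Module.finrank K K⟮x⟯ ≤ 2 := by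
  rw [adjoin.finrank (isIntegral_of_sq_eq hx)]
  have h : minpoly K x ∣ X ^ 2 - C c := minpoly.dvd K x (by simp [hx])
  calc (minpoly K x).natDegree ≤ (X ^ 2 - C c : K[X]).natDegree :=
        natDegree_le_of_dvd h (monic_X_pow_sub_C c two_ne_zero).ne_zero
    _ = 2 := natDegree_X_pow_sub_C

theorem finrank_adjoin_sqrt {c : K} {x : L} (hx : x ^ 2 = algebraMap K L c)
    (hx' : ∀ a : K, algebraMap K L a ≠ x) : Module.finrank K K⟮x⟯ = 2 := by
  have := adjoin.finiteDimensional (isIntegral_of_sq_eq hx)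
  have h1 : Module.finrank K K⟮x⟯ ≠ 1 := by
    rw [Ne, finrank_adjoin_simple_eq_one_iff, mem_bot]
    rintro ⟨a, ha⟩
    exact hx' a ha
  have h2 := finrank_adjoin_sqrt_le hx
  have h3 : 0 < Module.finrank K K⟮x⟯ := Module.finrank_pos
  omega

theorem exists_eq_add_mul_of_mem_adjoin_sqrt {c : K} {x : L} (hx : x ^ 2 = algebraMap K L c)
    {z : L} (hz : z ∈ K⟮x⟯) : ∃ a b : K, z = algebraMap K L a + algebraMap K L b * x := by
  rw [← mem_toSubalgebra, adjoin_simple_toSubalgebra_of_isAlgebraic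
    (isIntegral_of_sq_eq hx).isAlgebraic] at hz
  induction hz using Algebra.adjoin_induction with
  | mem y hy =>
    rw [Set.mem_singleton_iff] at hy
    exact ⟨0, 1, by simp [hy]⟩
  | algebraMap r => exact ⟨r, 0, by simp⟩
  | add y z _ _ hy hz =>
    obtain ⟨a, b, rfl⟩ := hy
    obtain ⟨a', b', rfl⟩ := hz
    exact ⟨a + a', b + b', by simp; ring⟩
  | mul y z _ _ hy hz =>
    obtain ⟨a, b, rfl⟩ := hy
    obtain ⟨a', b', rfl⟩ := hz
    refine ⟨a * a' + b * b' * c, a * b' + a' * b, ?_⟩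
    simp only [map_add, map_mul]
    linear_combination (algebraMap K L b * algebraMap K L b') * hx

end SquareRoots

/-! ### Integers and units of ℚ(i) -/

section Gaussian

/-- The ring of integers of a field `ℚ + ℚ i` with `i² = -1` is `ℤ[i]`. -/
theorem exists_ringEquiv_gaussianInt {F : Type*} [Field F] [NumberField F] {i : F}
    (hi : i * i = -1) (h : ∀ x : F, ∃ a b : ℚ, x = a + b * i) :
    ∃ e : GaussianInt ≃+* 𝓞 F, ∀ z : GaussianInt, (e z : F) = z.re + z.im * i := by
  let f : GaussianInt →+* F := Zsqrtd.lift ⟨i, by simpa using hi⟩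
  have hf : ∀ z : GaussianInt, f z = z.re + z.im * i := fun z => rfl
  have hinj : Function.Injective f := by
    rw [injective_iff_map_eq_zero]
    intro z hz
    rw [hf] at hz
    have h1 : ((z.re ^ 2 + z.im ^ 2 : ℤ) : F) = 0 := by
      push_cast
      linear_combination (z.re - z.im * i : F) * hz + (z.im : F) ^ 2 * hi
    have h2 : z.re ^ 2 + z.im ^ 2 = 0 := by exact_mod_cast h1
    have h3 : z.re = 0 := by nlinarith [sq_nonneg z.re, sq_nonneg z.im]
    have h4 : z.im = 0 := by nlinarith [sq_nonneg z.re, sq_nonneg z.im]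
    ext <;> simp [h3, h4]
  let _ : Algebra GaussianInt F := f.toAlgebra
  have halg : ∀ z : GaussianInt, algebraMap GaussianInt F z = f z := fun z => rfl
  have : FaithfulSMul GaussianInt F := (faithfulSMul_iff_algebraMap_injective _ _).mpr hinj
  have hfrac : IsFractionRing GaussianInt F := by
    refine IsFractionRing.of_field GaussianInt F fun x => ?_
    obtain ⟨a, b, rfl⟩ := h x
    refine ⟨⟨a.num * b.den, b.num * a.den⟩, ((a.den * b.den : ℕ) : GaussianInt), ?_⟩
    have ha : (a.den : F) ≠ 0 := by exact_mod_cast a.den_nz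
    have hb : (b.den : F) ≠ 0 := by exact_mod_cast b.den_nz
    rw [map_natCast, halg, hf]
    push_cast
    rw [Rat.cast_def a, Rat.cast_def b]
    field_simp
  have hint : ∀ z : GaussianInt, IsIntegral ℤ z := by
    intro z
    refine ⟨Polynomial.X ^ 2 - Polynomial.C (2 * z.re) * Polynomial.X +
      Polynomial.C (z.re ^ 2 + z.im ^ 2), ?_, ?_⟩
    · monicity!
    · simp only [Polynomial.eval₂_add, Polynomial.eval₂_sub, Polynomial.eval₂_mul,
        Polynomial.eval₂_pow, Polynomial.eval₂_X, Polynomial.eval₂_C]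
      apply hinj
      simp only [map_add, map_sub, map_mul, map_pow, map_zero, eq_intCast, map_intCast]
      rw [hf]
      push_cast
      linear_combination (z.im : F) ^ 2 * hi
  -- ℤ[i] is integral over ℤ and integrally closed in its fraction field F.
  have hic : IsIntegralClosure GaussianInt ℤ F := by
    refine ⟨hinj, fun {x} => ⟨fun hx => ?_, ?_⟩⟩
    · exact IsIntegrallyClosed.isIntegral_iff.mp hx.tower_top
    · rintro ⟨y, rfl⟩
      exact (hint y).algebraMap
  refine ⟨(NumberField.RingOfIntegers.equiv GaussianInt).symm, fun z => ?_⟩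
  rw [← hf, ← halg]
  exact IsIntegralClosure.algebraMap_equiv ℤ GaussianInt F (𝓞 F) z

/-- A unit has norm 1, which confines both coordinates to [-1, 1]. -/
instance : Finite GaussianIntˣ := by
  let g : GaussianIntˣ → Set.Icc (-1 : ℤ) 1 × Set.Icc (-1 : ℤ) 1 := fun u =>
    have h : u.val.re ^ 2 + u.val.im ^ 2 = 1 := by
      have h := (Zsqrtd.norm_eq_one_iff' (by norm_num) u.val).mpr u.isUnit
      rw [Zsqrtd.norm_def] at h
      linarith
    (⟨u.val.re, by constructor <;> nlinarith [sq_nonneg u.val.im]⟩,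
     ⟨u.val.im, by constructor <;> nlinarith [sq_nonneg u.val.re]⟩)
  refine Finite.of_injective g fun u v h => ?_
  simp only [g, Prod.mk.injEq] at h
  ext
  · exact congrArg Subtype.val h.1
  · exact congrArg Subtype.val h.2

end Gaussian

/-! ### Absence of real places and the unit rank -/

section Places

open NumberField

theorem isTotallyComplex_of_sq_eq_neg_one {k : Type*} [Field k] {i : k} (hi : i ^ 2 = -1) :
    IsTotallyComplex k := by
  refine ⟨fun v => ?_⟩
  rw [← InfinitePlace.not_isReal_iff_isComplex]
  intro hv
  have h := congrArg (InfinitePlace.embedding_of_isReal hv) hi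
  rw [map_pow, map_neg, map_one] at h
  nlinarith [sq_nonneg (InfinitePlace.embedding_of_isReal hv i)]

/-- There are at most two places, all complex, and the rank is one less than their number. -/
theorem units_rank_le_one {k : Type*} [Field k] [NumberField k] [IsTotallyComplex k]
    (h : Module.finrank ℚ k ≤ 4) : Units.rank k ≤ 1 := by
  have h1 := IsTotallyComplex.finrank (K := k)
  have h2 := IsTotallyComplex.nrRealPlaces_eq_zero k
  have h3 := InfinitePlace.card_eq_nrRealPlaces_add_nrComplexPlaces k
  rw [Units.rank]
  omega

end Places

/-! ### The field ℚ(√d, i) over ℚ(i) -/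

section Biquadratic

open IntermediateField

variable (d : ℕ)

/-- The square root of `d` in `ℚ(√d, i)`. -/
def sqrtElt : biquadraticField d :=
  ⟨((Real.sqrt d : ℝ) : ℂ), subset_adjoin ℚ _ (Set.mem_insert _ _)⟩

/-- The imaginary unit in `ℚ(√d, i)`. -/
def imagElt : biquadraticField d :=
  ⟨Complex.I, subset_adjoin ℚ _ (Set.mem_insert_of_mem _ rfl)⟩

theorem sqrtElt_sq : sqrtElt d ^ 2 = d := by
  apply Subtype.ext
  change ((Real.sqrt d : ℝ) : ℂ) ^ 2 = ((d : biquadraticField d) : ℂ)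
  rw [← Complex.ofReal_pow, Real.sq_sqrt (Nat.cast_nonneg d)]
  simp

theorem imagElt_sq : imagElt d ^ 2 = -1 := by
  apply Subtype.ext
  change Complex.I ^ 2 = ((-1 : biquadraticField d) : ℂ)
  simp

/-- The imaginary unit in `ℚ(i)`. -/
def gaussImag : gaussianSubfield d :=
  ⟨imagElt d, subset_adjoin ℚ _ rfl⟩

theorem gaussImag_sq : gaussImag d * gaussImag d = -1 := by
  apply Subtype.ext
  change imagElt d * imagElt d = -1
  rw [← sq, imagElt_sq]

theorem exists_eq_add_mul_gaussImag (x : gaussianSubfield d) :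
    ∃ a b : ℚ, x = a + b * gaussImag d := by
  obtain ⟨a, b, h⟩ := exists_eq_add_mul_of_mem_adjoin_sqrt (K := ℚ) (c := -1) (x := imagElt d)
    (by rw [imagElt_sq]; simp) x.2
  refine ⟨a, b, Subtype.ext ?_⟩
  rw [h]
  simp [gaussImag]

theorem adjoin_sqrtElt : (gaussianSubfield d)⟮sqrtElt d⟯ = ⊤ := by
  have h : ((gaussianSubfield d)⟮sqrtElt d⟯.restrictScalars ℚ) = ⊤ := by
    rw [eq_top_iff]
    rintro ⟨x, hx⟩ -
    induction hx using adjoin_induction with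
    | mem x hx =>
      rcases hx with rfl | hx
      · exact mem_adjoin_simple_self _ (sqrtElt d)
      · obtain rfl : x = Complex.I := hx
        exact _root_.algebraMap_mem (gaussianSubfield d)⟮sqrtElt d⟯ (gaussImag d)
    | algebraMap r => exact _root_.algebraMap_mem _ r
    | add x y hx hy h1 h2 => exact add_mem h1 h2
    | inv x hx h1 => exact inv_mem h1
    | mul x y hx hy h1 h2 => exact mul_mem h1 h2
  rw [eq_top_iff]
  intro x _
  have : x ∈ ((gaussianSubfield d)⟮sqrtElt d⟯.restrictScalars ℚ) := h ▸ mem_top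
  exact this

variable {d}

theorem algebraMap_ne_sqrtElt (hd : ¬ IsSquare d) (a : gaussianSubfield d) :
    algebraMap (gaussianSubfield d) (biquadraticField d) a ≠ sqrtElt d := by
  intro h
  obtain ⟨s, t, rfl⟩ := exists_eq_add_mul_gaussImag d a
  have h1 : ((s : ℂ) + t * Complex.I) = ((Real.sqrt d : ℝ) : ℂ) := by
    have := congrArg (fun x : biquadraticField d => (x : ℂ)) h
    simpa [gaussImag, imagElt, sqrtElt] using this
  have h2 := congrArg Complex.re h1
  simp at h2
  have h3 : Irrational (Real.sqrt d) := by
    rw [irrational_sqrt_natCast_iff]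
    exact hd
  exact h3 ⟨s, h2⟩

theorem finrank_gaussianSubfield (hd : ¬ IsSquare d) :
    Module.finrank (gaussianSubfield d) (biquadraticField d) = 2 := by
  rw [← finrank_top', ← adjoin_sqrtElt]
  exact finrank_adjoin_sqrt (c := (d : gaussianSubfield d)) (by rw [sqrtElt_sq, map_natCast])
    (algebraMap_ne_sqrtElt hd)

theorem isGalois_gaussianSubfield (hd : ¬ IsSquare d) :
    IsGalois (gaussianSubfield d) (biquadraticField d) :=
  have : Algebra.IsQuadraticExtension (gaussianSubfield d) (biquadraticField d) :=
    ⟨finrank_gaussianSubfield hd⟩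
  inferInstance

theorem finrank_biquadraticField_le (hd : ¬ IsSquare d) :
    Module.finrank ℚ (biquadraticField d) ≤ 4 := by
  rw [← Module.finrank_mul_finrank ℚ (gaussianSubfield d) (biquadraticField d),
    finrank_gaussianSubfield hd]
  have : Module.finrank ℚ (gaussianSubfield d) ≤ 2 :=
    finrank_adjoin_sqrt_le (c := -1) (x := imagElt d) (by rw [imagElt_sq]; simp)
  omega

instance : NumberField.IsTotallyComplex (biquadraticField d) :=
  isTotallyComplex_of_sq_eq_neg_one (imagElt_sq d)

theorem conj_sqrtElt (τ : Gal((biquadraticField d)/(gaussianSubfield d))) :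
    τ (sqrtElt d) = sqrtElt d ∨ τ (sqrtElt d) = -sqrtElt d := by
  apply sq_eq_sq_iff_eq_or_eq_neg.mp
  rw [← map_pow, sqrtElt_sq, map_natCast]

theorem exists_conj (hd : ¬ IsSquare d) :
    ∃ σ : Gal((biquadraticField d)/(gaussianSubfield d)), σ ≠ 1 ∧ ∀ τ, τ = 1 ∨ τ = σ := by
  have := isGalois_gaussianSubfield hd
  have hcard : Nat.card Gal((biquadraticField d)/(gaussianSubfield d)) = 2 := by
    rw [IsGalois.card_aut_eq_finrank, finrank_gaussianSubfield hd]
  obtain ⟨σ, hσ, h⟩ := (Nat.card_eq_two_iff' 1).mp hcard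
  refine ⟨σ, hσ, fun τ => ?_⟩
  by_cases hτ : τ = 1
  · exact Or.inl hτ
  · exact Or.inr (h τ hτ)

theorem exists_gaussianInt_equiv (d : ℕ) :
    ∃ e : GaussianInt ≃+* 𝓞 (gaussianSubfield d), ∀ z : GaussianInt,
      (algebraMap (gaussianSubfield d) (biquadraticField d) (e z) : ℂ) = z := by
  obtain ⟨e, he⟩ := exists_ringEquiv_gaussianInt (gaussImag_sq d) (exists_eq_add_mul_gaussImag d)
  refine ⟨e, fun z => ?_⟩
  rw [he, GaussianInt.toComplex_def]
  simp [gaussImag, imagElt]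

end Biquadratic

/-! ### The ideals (a, √d) and when they become principal -/

section Ideals

variable {R : Type*} [CommRing R]

/-- If `r² = a b` with `a`, `b` coprime, then `(a, r)² = (a)`. -/
theorem span_pair_sq_eq {a b r : R} (h : r ^ 2 = a * b) (hab : IsCoprime a b) :
    Ideal.span {a, r} ^ 2 = Ideal.span {a} := by
  rw [sq, Ideal.span_pair_mul_span_pair]
  obtain ⟨u, v, huv⟩ := hab
  apply le_antisymm
  · rw [Ideal.span_le]
    rintro x (rfl | rfl | rfl | rfl)
    · exact Ideal.mem_span_singleton.mpr ⟨a, rfl⟩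
    · exact Ideal.mem_span_singleton.mpr ⟨r, rfl⟩
    · exact Ideal.mem_span_singleton.mpr ⟨r, mul_comm _ _⟩
    · exact Ideal.mem_span_singleton.mpr ⟨b, by rw [← sq, h]⟩
  · rw [Ideal.span_singleton_le_iff_mem]
    -- Multiply u a + v b = 1 by a and replace a b by r².
    have ha : u * (a * a) + v * (r * r) = a := by
      rw [← sq r, h]
      linear_combination a * huv
    have hmem : u * (a * a) + v * (r * r) ∈ Ideal.span {a * a, a * r, r * a, r * r} :=
      add_mem (Ideal.mul_mem_left _ _ (Ideal.subset_span (by simp)))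
        (Ideal.mul_mem_left _ _ (Ideal.subset_span (by simp)))
    rwa [ha] at hmem

end Ideals

section PrincipalExtension

variable {G : Type*} [Field G]

/-- If `r² = a b` with `a`, `b` coprime and `a` is a unit times a square `α²`, then
`(a, r) = (α)`. -/
theorem span_pair_eq_span_of_sq {a b r α : 𝓞 G} {v : 𝓞 G} (hv : IsUnit v) (ha : a ≠ 0)
    (h : r ^ 2 = a * b) (hab : IsCoprime a b) (hα : α ^ 2 = v * a) :
    Ideal.span {a, r} = Ideal.span {α} := by
  obtain ⟨v, rfl⟩ := hv
  have hα0 : α ≠ 0 := by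
    rintro rfl
    rw [zero_pow two_ne_zero] at hα
    exact mul_ne_zero v.ne_zero ha hα.symm
  have hαG : (α : G) ≠ 0 := by rwa [NumberField.RingOfIntegers.coe_ne_zero_iff]
  have haG : (a : G) ≠ 0 := by rwa [NumberField.RingOfIntegers.coe_ne_zero_iff]
  have haα : a = α * (((v⁻¹ : (𝓞 G)ˣ) : 𝓞 G) * α) := by
    rw [mul_left_comm, ← sq, hα, ← mul_assoc, Units.inv_mul, one_mul]
  have hαG2 : (α : G) ^ 2 = ((v : 𝓞 G) : G) * a := by rw [← map_pow, hα, map_mul]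
  have hrG : (r : G) ^ 2 = a * b := by rw [← map_pow, h, map_mul]
  have hvG : ((v : 𝓞 G) : G) * (((v⁻¹ : (𝓞 G)ˣ) : 𝓞 G) : G) = 1 := by
    rw [← map_mul, Units.mul_inv, map_one]
  -- Its square is v⁻¹ b, so α divides r as well as a.
  have hint : IsIntegral ℤ ((r : G) / α) := by
    refine IsIntegral.of_pow two_pos ?_
    have : ((r : G) / α) ^ 2 = ((((v⁻¹ : (𝓞 G)ˣ) : 𝓞 G) * b : 𝓞 G) : G) := by
      have hm : ((((v⁻¹ : (𝓞 G)ˣ) : 𝓞 G) * b : 𝓞 G) : G) = (((v⁻¹ : (𝓞 G)ˣ) : 𝓞 G) : G) * b :=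
        map_mul (algebraMap (𝓞 G) G) _ _
      rw [div_pow, hrG, hαG2, hm, div_eq_iff (by rw [← hαG2]; exact pow_ne_zero 2 hαG)]
      linear_combination -(a * b : G) * hvG
    rw [this]
    exact NumberField.RingOfIntegers.isIntegral_coe _
  let t : 𝓞 G := ⟨(r : G) / α, hint⟩
  have hr : r = α * t := by
    apply NumberField.RingOfIntegers.coe_injective
    rw [map_mul]
    exact (mul_div_cancel₀ _ hαG).symm
  obtain ⟨x, y, hxy⟩ := hab
  apply le_antisymm
  · rw [Ideal.span_le]
    rintro z (rfl | rfl)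
    · exact Ideal.mem_span_singleton.mpr ⟨_, haα⟩
    · exact Ideal.mem_span_singleton.mpr ⟨_, hr⟩
  · rw [Ideal.span_singleton_le_iff_mem, Ideal.mem_span_pair]
    have hb : b = v * t ^ 2 := by
      apply mul_left_cancel₀ ha
      rw [← h, hr, mul_pow, hα]
      ring
    refine ⟨x * α, y * t * v, ?_⟩
    rw [hb] at hxy
    rw [hr]
    linear_combination α * hxy

/-- Since w has trace 2x and norm p y² = (y s)², (w + y s)² = 2w(x + y s). With (1 + i)² = 2i and w
= uπz², the element (w + y s)/((1 + i)z) has square -i(x + y s)u · π. Here x + y s is a unit, as (x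
+ y s)(y s - x) = p y² - x² = 1. -/
theorem exists_sq_eq_unit_mul [CharZero G] (φ : GaussianInt →+* 𝓞 G) {p : ℕ} {s : 𝓞 G}
    (hs : s ^ 2 = p) {x y : ℤ} (hxy : x ^ 2 + 1 = p * y ^ 2) {w π z u : GaussianInt}
    (hw : w + star w = 2 * x) (hww : w * star w = p * y ^ 2) (hu : IsUnit u)
    (h : w = u * π * z ^ 2) :
    ∃ α v : 𝓞 G, IsUnit v ∧ α ^ 2 = v * φ π := by
  set i := φ ⟨0, 1⟩ with hi
  have hi2 : i * i = -1 := by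
    rw [hi, ← map_mul, ← map_one φ, ← map_neg]
    rfl
  have hunit : IsUnit (-i * (x + y * s) * φ u) := by
    refine IsUnit.mul (IsUnit.mul ?_ ?_) (hu.map φ)
    · exact IsUnit.of_mul_eq_one i (by linear_combination -hi2)
    · refine IsUnit.of_mul_eq_one (y * s - x) ?_
      have : ((x ^ 2 + 1 : ℤ) : 𝓞 G) = ((p * y ^ 2 : ℤ) : 𝓞 G) := by rw [hxy]
      push_cast at this
      linear_combination (y : 𝓞 G) ^ 2 * hs - this
  have hφw : φ w + φ (star w) = 2 * x := by
    rw [← map_add, hw, map_mul, map_ofNat, map_intCast]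
  have hφww : φ w * φ (star w) = p * y ^ 2 := by
    rw [← map_mul, hww]
    simp
  have hφ : φ w = φ u * φ π * φ z ^ 2 := by rw [h]; simp
  have hz : (φ z : G) ≠ 0 := by
    rw [NumberField.RingOfIntegers.coe_ne_zero_iff]
    intro hz
    rw [hφ, hz] at hφww
    have : ((x ^ 2 + 1 : ℤ) : 𝓞 G) = 0 := by
      rw [hxy]
      push_cast
      linear_combination -hφww
    have h0 : x ^ 2 + 1 = 0 := by exact_mod_cast this
    nlinarith [sq_nonneg x]
  have hi1 : (1 + i : G) ≠ 0 := by
    intro h0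
    have h1 : (i : G) * i = -1 := by rw [← map_mul, hi2, map_neg, map_one]
    have h2 : (2 : G) = 0 := by linear_combination (1 - (i : G)) * h0 + h1
    exact two_ne_zero h2
  set α : G := (φ w + y * s) / ((1 + i) * φ z) with hα
  have hα2 : α ^ 2 = ((-i * (x + y * s) * φ u * φ π : 𝓞 G) : G) := by
    have e : (φ w + y * s) ^ 2 = (-i * (x + y * s) * φ u * φ π) * ((1 + i) * φ z) ^ 2 := by
      have e1 : (1 + i) ^ 2 = 2 * i := by linear_combination hi2
      have e2 : (φ w + y * s) ^ 2 = 2 * φ w * (x + y * s) := by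
        linear_combination φ w * hφw + (y : 𝓞 G) ^ 2 * hs - hφww
      rw [e2, mul_pow, e1, hφ]
      linear_combination (2 * (x + y * s) * φ u * φ π * φ z ^ 2) * hi2
    have e' := congrArg (algebraMap (𝓞 G) G) e
    rw [hα, div_pow, div_eq_iff (pow_ne_zero 2 (mul_ne_zero hi1 hz))]
    simpa using e'
  have hint : IsIntegral ℤ α := by
    refine IsIntegral.of_pow two_pos ?_
    rw [hα2]
    exact NumberField.RingOfIntegers.isIntegral_coe _
  obtain ⟨A, hA⟩ : ∃ A : 𝓞 G, (A : G) = α := ⟨⟨α, hint⟩, rfl⟩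
  refine ⟨A, _, hunit, ?_⟩
  apply NumberField.RingOfIntegers.coe_injective
  rw [map_pow]
  change (A : G) ^ 2 = _
  rw [hA]
  exact hα2

end PrincipalExtension

/-! ### Unramified quadratic extensions and square roots in the genus field -/

section Unramified

open IntermediateField

/-- For m ≡ 1 mod 4, θ = (1 + s)/2 is an integral generator annihilated by X² - X - (m - 1)/4, whose
derivative at θ is s. So m = s² lies in the different, likewise n, and coprimality makes the
different trivial. -/
theorem isUnramifiedAt_of_sqrt {k L : Type*} [Field k] [NumberField k] [Field L] [NumberField L]
    [Algebra k L] {m n : ℤ} (hm : m % 4 = 1) (hn : n % 4 = 1) (hmn : IsCoprime m n) {s t : L}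
    (hs : s ^ 2 = m) (ht : t ^ 2 = n) (hs' : k⟮s⟯ = ⊤) (ht' : k⟮t⟯ = ⊤)
    (P : Ideal (𝓞 L)) [P.IsPrime] : Algebra.IsUnramifiedAt (𝓞 k) P := by
  have key : ∀ {m : ℤ} {s : L}, m % 4 = 1 → s ^ 2 = m → k⟮s⟯ = ⊤ →
      (m : 𝓞 L) ∈ differentIdeal (𝓞 k) (𝓞 L) := by
    intro m s hm hs htop
    obtain ⟨c, rfl⟩ : ∃ c, m = 4 * c + 1 := ⟨m / 4, by omega⟩
    have hint : IsIntegral ℤ ((1 + s) / 2) := by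
      refine ⟨Polynomial.X ^ 2 - Polynomial.X - Polynomial.C c, by monicity!, ?_⟩
      simp only [Polynomial.eval₂_sub, Polynomial.eval₂_pow, Polynomial.eval₂_X,
        Polynomial.eval₂_C]
      rw [eq_intCast]
      push_cast at hs
      linear_combination (1 / 4 : L) * hs
    let θ : 𝓞 L := ⟨(1 + s) / 2, hint⟩
    have hθ : (θ : L) = (1 + s) / 2 := rfl
    have hadj : Algebra.adjoin k {algebraMap (𝓞 L) L θ} = ⊤ := by
      have h1 : k⟮(θ : L)⟯ = ⊤ := by
        rw [eq_top_iff, ← htop, adjoin_simple_le_iff]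
        have : s = 2 * (θ : L) - 1 := by rw [hθ]; ring
        rw [this]
        exact sub_mem (mul_mem (ofNat_mem _ 2) (mem_adjoin_simple_self k _)) (one_mem _)
      rw [← adjoin_simple_toSubalgebra_of_isAlgebraic (Algebra.IsAlgebraic.isAlgebraic _), h1,
        top_toSubalgebra]
    have hmem := aeval_derivative_mem_differentIdeal (𝓞 k) k L θ hadj
    -- Divisibility suffices: differentiating at θ makes 2θ - 1 a multiple of the derivative of the
    -- minimal polynomial, so the case L = k needs no separate treatment.
    obtain ⟨g, hg⟩ : minpoly (𝓞 k) θ ∣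
        Polynomial.X ^ 2 - Polynomial.X - Polynomial.C (c : 𝓞 k) := by
      apply minpoly.isIntegrallyClosed_dvd (Algebra.IsIntegral.isIntegral θ)
      apply NumberField.RingOfIntegers.coe_injective
      push_cast at hs
      simp only [map_sub, map_pow, Polynomial.aeval_X, map_intCast, map_zero, hθ]
      linear_combination (1 / 4 : L) * hs
    have hd := congrArg (fun f => Polynomial.aeval θ (Polynomial.derivative f)) hg
    simp only [Polynomial.derivative_mul, Polynomial.derivative_X_pow,
      Polynomial.derivative_X, Polynomial.derivative_C, map_add, map_mul, map_sub, minpoly.aeval,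
      zero_mul, add_zero] at hd
    have h2 : (2 * θ - 1) ∈ differentIdeal (𝓞 k) (𝓞 L) := by
      have : 2 * θ - 1 = Polynomial.aeval θ (Polynomial.derivative (minpoly (𝓞 k) θ)) *
          Polynomial.aeval θ g := by
        simpa [map_ofNat (algebraMap (𝓞 k) (𝓞 L))] using hd
      rw [this]
      exact Ideal.mul_mem_right _ _ hmem
    have h3 : ((4 * c + 1 : ℤ) : 𝓞 L) = (2 * θ - 1) * (2 * θ - 1) := by
      apply NumberField.RingOfIntegers.coe_injective
      rw [map_intCast, ← hs]
      simp only [map_mul, map_sub, map_ofNat, map_one, hθ]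
      ring
    rw [h3]
    exact Ideal.mul_mem_left _ _ h2
  have htop : differentIdeal (𝓞 k) (𝓞 L) = ⊤ := by
    rw [Ideal.eq_top_iff_one]
    obtain ⟨a, b, hab⟩ := hmn
    have : (1 : 𝓞 L) = a * m + b * n := by exact_mod_cast hab.symm
    rw [this]
    exact add_mem (Ideal.mul_mem_left _ _ (key hm hs hs')) (Ideal.mul_mem_left _ _ (key hn ht ht'))
  rw [← not_dvd_differentIdeal_iff, htop, ← Ideal.one_eq_top]
  intro h
  exact Ideal.IsPrime.ne_top' (Ideal.isUnit_iff.mp (isUnit_of_dvd_one h))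

theorem isUnramifiedAtInfinitePlaces_of_isTotallyComplex (k L : Type*) [Field k] [Field L]
    [Algebra k L] [NumberField.IsTotallyComplex k] : IsUnramifiedAtInfinitePlaces k L :=
  ⟨fun _ => NumberField.InfinitePlace.isUnramified_iff.mpr
    (Or.inr (NumberField.IsTotallyComplex.isComplex _))⟩

end Unramified

section GenusField

open IntermediateField

theorem isAbelianGalois_adjoin_sqrt {L : Type*} [Field L] [CharZero L] {m : ℤ} {s : L}
    (hs : s ^ 2 = m) (hs' : ∀ a : ℚ, (a : L) ≠ s) : IsAbelianGalois ℚ ℚ⟮s⟯ := by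
  have : Algebra.IsQuadraticExtension ℚ ℚ⟮s⟯ :=
    ⟨finrank_adjoin_sqrt (c := (m : ℚ)) (by simpa using hs) (by simpa using hs')⟩
  exact {}

theorem adjoin_coe_adjoin_simple {k Ω : Type*} [Field k] [Field Ω] [CharZero k] [CharZero Ω]
    [Algebra k Ω] (s : Ω) : adjoin k (ℚ⟮s⟯ : Set Ω) = k⟮s⟯ := by
  apply le_antisymm
  · rw [adjoin_le_iff]
    intro x hx
    have : ℚ⟮s⟯ ≤ (k⟮s⟯).restrictScalars ℚ := by
      rw [adjoin_simple_le_iff]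
      exact mem_adjoin_simple_self k s
    exact this hx
  · rw [adjoin_simple_le_iff]
    exact subset_adjoin k _ (mem_adjoin_simple_self ℚ s)

/-- If `-d = m n` with `m ≡ n ≡ 1 [ZMOD 4]` coprime, then `√m` lies in the genus field of
`ℚ(√d, i)`. -/
theorem mem_genusField_of_sq_eq {d : ℕ} (hd : d ≠ 0) {m n : ℤ} (hmn : m * n = -d)
    (hm : m % 4 = 1) (hn : n % 4 = 1) (hcop : IsCoprime m n) {s : ℂ} (hs : s ^ 2 = m)
    (hs' : ∀ a : ℚ, (a : ℂ) ≠ s) : s ∈ genusField (biquadraticField d) ℂ := by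
  set k := biquadraticField d with hk
  have hm0 : (m : ℂ) ≠ 0 := by
    have : m ≠ 0 := by omega
    exact_mod_cast this
  have hs0 : s ≠ 0 := by
    rintro rfl
    exact hm0 (by rw [← hs]; simp)
  let r : k := imagElt d * sqrtElt d
  have hr : ((r : ℂ)) ^ 2 = -d := by
    have : r ^ 2 = -d := by rw [mul_pow, imagElt_sq, sqrtElt_sq]; ring
    have := congrArg (algebraMap k ℂ) this
    rw [map_pow, map_neg, map_natCast] at this
    exact this
  have hr0 : (r : ℂ) ≠ 0 := by
    intro h
    rw [h] at hr
    have : (d : ℂ) = 0 := by simpa using hr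
    exact hd (by exact_mod_cast this)
  let L : IntermediateField k ℂ := k⟮s⟯
  have hrL : (r : ℂ) ∈ L := IntermediateField.algebraMap_mem L r
  have hsL : s ∈ L := mem_adjoin_simple_self k s
  let s' : L := ⟨s, hsL⟩
  -- With r = i√d in k, r² = -d = m n, so r/s is a square root of n generating the same extension.
  let t' : L := ⟨r / s, div_mem hrL hsL⟩
  have hs2 : s' ^ 2 = m := by
    apply Subtype.ext
    simpa [s'] using hs
  have ht2 : t' ^ 2 = n := by
    apply Subtype.ext
    simp only [t', SubmonoidClass.coe_pow, SubringClass.coe_intCast]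
    have : (m : ℂ) * n = -d := by exact_mod_cast hmn
    rw [div_pow, hr, hs, ← this, mul_div_cancel_left₀ _ hm0]
  have hfin : FiniteDimensional k L := by
    apply adjoin.finiteDimensional
    exact isIntegral_of_sq_eq (c := (m : k)) (by simpa using hs)
  have : NumberField L := NumberField.of_module_finite k L
  have hs_eq : k⟮s'⟯ = ⊤ := by
    apply lift_injective L
    rw [lift_adjoin_simple, lift_top]
  have ht_eq : k⟮t'⟯ = ⊤ := by
    apply lift_injective L
    rw [lift_adjoin_simple, lift_top]
    apply le_antisymm
    · rw [adjoin_simple_le_iff]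
      exact t'.2
    · rw [adjoin_simple_le_iff]
      have : s = r / (r / s) := by field_simp
      rw [this]
      exact div_mem (IntermediateField.algebraMap_mem _ r) (mem_adjoin_simple_self k _)
  have hmem : L ∈ genusExtensions k ℂ := by
    refine ⟨hfin, ⟨fun P _ _ => isUnramifiedAt_of_sqrt hm hn hcop hs2 ht2 hs_eq ht_eq P,
      isUnramifiedAtInfinitePlaces_of_isTotallyComplex k L⟩, ℚ⟮s⟯,
      isAbelianGalois_adjoin_sqrt hs hs', (adjoin_coe_adjoin_simple s).symm⟩
  exact (le_sSup hmem : L ≤ genusField k ℂ) hsL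

/-- Uses -d = p · (-n), both factors being 1 mod 4. -/
theorem sqrt_mem_genusField {p d n : ℕ} (hp : p.Prime) (hd : d = p * n) (hp4 : p % 4 = 1)
    (hn4 : n % 4 = 3) (hcop : Nat.Coprime p n) :
    ((Real.sqrt p : ℝ) : ℂ) ∈ genusField (biquadraticField d) ℂ := by
  refine mem_genusField_of_sq_eq (m := p) (n := -n) ?_ ?_ (by omega) (by omega) ?_ ?_ ?_
  · rw [hd]
    have : n ≠ 0 := by omega
    exact mul_ne_zero hp.ne_zero this
  · rw [hd]
    push_cast
    ring
  · exact (Nat.isCoprime_iff_coprime.mpr hcop).neg_right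
  · rw [← Complex.ofReal_pow, Real.sq_sqrt (Nat.cast_nonneg p)]
    simp
  · intro a ha
    have h2 := congrArg Complex.re ha
    simp at h2
    exact (Nat.Prime.irrational_sqrt hp) ⟨a, h2⟩

/-- Uses -d = (-q) · n, which puts i√q in the genus field; i already lies in the base. -/
theorem sqrt_mem_genusField' {q d n : ℕ} (hq : q.Prime) (hd : d = q * n) (hq4 : q % 4 = 3)
    (hn4 : n % 4 = 1) (hcop : Nat.Coprime q n) :
    ((Real.sqrt q : ℝ) : ℂ) ∈ genusField (biquadraticField d) ℂ := by
  have hq0 : (0 : ℝ) < q := by exact_mod_cast hq.pos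
  have h : Complex.I * ((Real.sqrt q : ℝ) : ℂ) ∈ genusField (biquadraticField d) ℂ := by
    refine mem_genusField_of_sq_eq (m := -q) (n := n) ?_ ?_ (by omega) (by omega) ?_ ?_ ?_
    · rw [hd]
      have : n ≠ 0 := by omega
      exact mul_ne_zero hq.ne_zero this
    · rw [hd]
      push_cast
      ring
    · exact (Nat.isCoprime_iff_coprime.mpr hcop).neg_left
    · rw [mul_pow, Complex.I_sq, ← Complex.ofReal_pow, Real.sq_sqrt hq0.le]
      simp
    · intro a ha
      have h2 := congrArg Complex.im ha
      simp at h2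
      exact (Real.sqrt_pos.mpr hq0).ne h2
  have hI : Complex.I ∈ genusField (biquadraticField d) ℂ :=
    IntermediateField.algebraMap_mem _ (imagElt d)
  have : ((Real.sqrt q : ℝ) : ℂ) = -(Complex.I * (Complex.I * ((Real.sqrt q : ℝ) : ℂ))) := by
    rw [← mul_assoc, Complex.I_mul_I]
    ring
  rw [this]
  exact neg_mem (mul_mem hI h)

end GenusField

/-! ### The genus field involves only 2-power degrees -/

section OddDegree

theorem ramificationIdx_int_dvd_finrank (K : Type*) [Field K] [NumberField K] [IsGalois ℚ K]
    (P : Ideal (𝓞 K)) [P.IsPrime] : P.ramificationIdx ℤ ∣ Module.finrank ℚ K := by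
  have h := Ideal.ncard_primesOver_mul_ramificationIdxIn_mul_inertiaDegIn (P.under ℤ) (𝓞 K)
    Gal(K/ℚ)
  rw [Ideal.ramificationIdxIn_eq_ramificationIdx (P.under ℤ) P Gal(K/ℚ),
    IsGalois.card_aut_eq_finrank] at h
  rw [← h]
  exact Dvd.dvd.mul_left (Dvd.intro _ rfl) _

/-- A Galois number field of odd degree contained in an unramified extension of a Galois number
field of `2`-power degree is `ℚ`. -/
theorem finrank_eq_one_of_odd {k K L : Type*} [Field k] [NumberField k] [Field K] [NumberField K]
    [Field L] [NumberField L] [Algebra k L] [Algebra K L] [IsGalois ℚ k] [IsGalois ℚ K]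
    {m : ℕ} (hk : Module.finrank ℚ k ∣ 2 ^ m) (hK : Odd (Module.finrank ℚ K))
    (hL : ∀ (P : Ideal (𝓞 L)) [P.IsPrime], P ≠ ⊥ → Algebra.IsUnramifiedAt (𝓞 k) P) :
    Module.finrank ℚ K = 1 := by
  by_contra hne
  -- By Minkowski some P ramifies over ℤ. A prime Q of L above P has ramification index over ℤ
  -- dividing 2 ^ m, computed through k, while the index of P is odd because K is Galois of odd
  -- degree; hence the latter is 1.
  obtain ⟨P, hP, hram⟩ := NumberField.exists_not_isUnramifiedAt_int (𝒪 := 𝓞 K) hne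
  obtain ⟨⟨Q, hQ, hQP⟩⟩ : Nonempty (Ideal.primesOver P (𝓞 L)) := inferInstance
  have hP0 : P ≠ ⊥ := Ideal.IsMaximal.ne_bot_of_isIntegral_int P
  have hQ0 : Q ≠ ⊥ := Ideal.ne_bot_of_liesOver_of_ne_bot hP0 Q
  have h1 : Q.ramificationIdx ℤ = P.ramificationIdx ℤ * Q.ramificationIdx (𝓞 K) :=
    Ideal.ramificationIdx_tower P Q
  have h2 : Q.ramificationIdx ℤ =
      (Q.under (𝓞 k)).ramificationIdx ℤ * Q.ramificationIdx (𝓞 k) :=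
    Ideal.ramificationIdx_tower (Q.under (𝓞 k)) Q
  have := hL Q hQ0
  rw [Ideal.ramificationIdx_eq_one Q (𝓞 k), mul_one] at h2
  have h3 : P.ramificationIdx ℤ ∣ 2 ^ m := by
    refine Dvd.dvd.trans ⟨_, h1⟩ ?_
    rw [h2]
    exact (ramificationIdx_int_dvd_finrank k _).trans hk
  have h4 : Odd (P.ramificationIdx ℤ) := hK.of_dvd_nat (ramificationIdx_int_dvd_finrank K P)
  have h5 : P.ramificationIdx ℤ = 1 :=
    Nat.Coprime.eq_one_of_dvd (h4.coprime_two_right.pow_right m) h3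
  exact hram ((Ideal.ramificationIdx_eq_one_iff).mp h5)

end OddDegree

section Compositum

open IntermediateField

/-- An abelian number field contained in an unramified extension of a Galois number field of
`2`-power degree has `2`-power degree. -/
theorem exists_finrank_eq_two_pow {k M L : Type*} [Field k] [NumberField k] [Field M]
    [NumberField M] [Field L] [NumberField L] [Algebra k L] [Algebra M L] [IsGalois ℚ k]
    [IsAbelianGalois ℚ M] {m : ℕ} (hk : Module.finrank ℚ k ∣ 2 ^ m)
    (hL : ∀ (P : Ideal (𝓞 L)) [P.IsPrime], P ≠ ⊥ → Algebra.IsUnramifiedAt (𝓞 k) P) :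
    ∃ a : ℕ, Module.finrank ℚ M = 2 ^ a := by
  let H : Sylow 2 Gal(M/ℚ) := default
  -- The fixed field of the Sylow 2-subgroup has odd degree and must therefore be ℚ.
  let K := fixedField (H : Subgroup Gal(M/ℚ))
  have hcard : Module.finrank K M = Nat.card H := finrank_fixedField_eq_card _
  have hmul := Module.finrank_mul_finrank ℚ K M
  have hidx : Module.finrank ℚ K = (H : Subgroup Gal(M/ℚ)).index := by
    have h := (H : Subgroup Gal(M/ℚ)).index_mul_card
    rw [IsGalois.card_aut_eq_finrank, ← hmul, hcard] at h
    exact (Nat.eq_of_mul_eq_mul_right Nat.card_pos h).symm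
  have hnorm : (H : Subgroup Gal(M/ℚ)).Normal := by
    open scoped IsMulCommutative in infer_instance
  have hodd : Odd (Module.finrank ℚ K) := by
    rw [hidx, ← Nat.not_even_iff_odd, even_iff_two_dvd]
    exact H.not_dvd_index
  let _ : Algebra K L := ((algebraMap M L).comp (algebraMap K M)).toAlgebra
  have hab : IsAbelianGalois ℚ K := IsAbelianGalois.tower_bot ℚ K M
  have h1 : Module.finrank ℚ K = 1 := finrank_eq_one_of_odd (k := k) (L := L) hk hodd hL
  rw [h1, one_mul, hcard] at hmul
  obtain ⟨a, ha⟩ := IsPGroup.iff_card.mp H.2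
  exact ⟨a, hmul.symm.trans ha⟩

/-- The compositum of `k` with a finite Galois extension of a subfield is normal over `k`. -/
theorem normal_adjoin_coe {F k Ω : Type*} [Field F] [Field k] [Field Ω] [Algebra F k] [Algebra k Ω]
    [Algebra F Ω] [IsScalarTower F k Ω] (M : IntermediateField F Ω) [IsGalois F M]
    [FiniteDimensional F M] : Normal k (adjoin k (M : Set Ω)) := by
  obtain ⟨T, hT₁, hT₂⟩ := IsGalois.is_separable_splitting_field F M
  rw [IntermediateField.isSplittingField_iff] at hT₂
  have hsplit : ((T.map (algebraMap F k)).map (algebraMap k Ω)).Splits := by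
    rw [Polynomial.map_map, ← IsScalarTower.algebraMap_eq]
    exact Polynomial.Splits.of_algHom hT₂.1 (IsScalarTower.toAlgHom F M Ω)
  have hroots : (T.map (algebraMap F k)).rootSet Ω = T.rootSet Ω := by
    simp [Set.ext_iff, Polynomial.mem_rootSet']
  have heq : adjoin k (M : Set Ω) = adjoin k ((T.map (algebraMap F k)).rootSet Ω) := by
    rw [hroots]
    apply le_antisymm
    · rw [adjoin_le_iff]
      have : M ≤ (adjoin k (T.rootSet Ω)).restrictScalars F := by
        rw [hT₂.2, adjoin_le_iff]
        exact subset_adjoin k _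
      exact this
    · apply adjoin.mono
      intro x hx
      rw [hT₂.2]
      exact subset_adjoin F _ hx
  rw [heq]
  exact Normal.of_isSplittingField (hFEp := adjoin_rootSet_isSplittingField hsplit)

/-- Elements of the genus field have `2`-power degree over the base field, if the base field is
Galois over `ℚ` of `2`-power degree. -/
theorem exists_finrank_adjoin_eq_two_pow {k Ω : Type*} [Field k] [NumberField k] [Field Ω]
    [CharZero Ω] [Algebra k Ω] [IsGalois ℚ k] {m : ℕ} (hk : Module.finrank ℚ k ∣ 2 ^ m) {γ : Ω}
    (hγ : γ ∈ genusField k Ω) : IsIntegral k γ ∧ ∃ a : ℕ, Module.finrank k k⟮γ⟯ = 2 ^ a := by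
  rw [genusField, sSup_eq_iSup'] at hγ
  -- Membership in the compositum involves finitely many extensions, so one can work in a finite
  -- normal field E.
  obtain ⟨s, hs⟩ := exists_finset_of_mem_iSup hγ
  let E : IntermediateField k Ω := ⨆ L : s, (L : IntermediateField k Ω)
  have hγE : γ ∈ E := by
    simpa only [E, iSup_subtype'] using hs
  have hfinL : ∀ L : s, FiniteDimensional k ((L : genusExtensions k Ω) : IntermediateField k Ω) :=
    fun L => L.1.2.1
  have hfinE : FiniteDimensional k E := finiteDimensional_iSup_of_finite
  choose M hMab hLM using fun L : s => L.1.2.2.2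
  have hML : ∀ L : s, M L ≤ ((L : genusExtensions k Ω) : IntermediateField k Ω).restrictScalars ℚ := by
    intro L x hx
    change x ∈ ((L : genusExtensions k Ω) : IntermediateField k Ω)
    rw [hLM L]
    exact subset_adjoin k _ hx
  have hNL : ∀ L : s, NumberField ((L : genusExtensions k Ω) : IntermediateField k Ω) := fun L =>
    have := hfinL L
    NumberField.of_module_finite k _
  have hNM : ∀ L : s, FiniteDimensional ℚ (M L) := by
    intro L
    have : FiniteDimensional ℚ
      (((L : genusExtensions k Ω) : IntermediateField k Ω).restrictScalars ℚ) :=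
        (hNL L).to_finiteDimensional
    exact FiniteDimensional.of_injective (inclusion (hML L)).toLinearMap
      (inclusion_injective (hML L))
  have hdeg : ∀ L : s, ∃ a : ℕ, Module.finrank ℚ (M L) = 2 ^ a := by
    intro L
    have := hNL L
    have : NumberField (M L) := { to_finiteDimensional := hNM L }
    let _ : Algebra (M L) ((L : genusExtensions k Ω) : IntermediateField k Ω) :=
      (inclusion (hML L)).toRingHom.toAlgebra
    have := hMab L
    exact exists_finrank_eq_two_pow (k := k)
      (L := ((L : genusExtensions k Ω) : IntermediateField k Ω)) hk
      (fun P _ hP => L.1.2.2.1.1 P hP)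
  have hnorm : ∀ L : s, Normal k ((L : genusExtensions k Ω) : IntermediateField k Ω) := by
    intro L
    have := hNM L
    have : @IsGalois ℚ _ (M L) _ (IntermediateField.algebra' (M L)) := (hMab L).toIsGalois
    rw [hLM L]
    exact normal_adjoin_coe (M L)
  have hnE : Normal k E := normal_iSup k Ω _
  have hgal : IsGalois k E := {}
  choose a ha using hdeg
  have hME : ∀ L : s, M L ≤ E.restrictScalars ℚ := fun L =>
    (hML L).trans (fun x hx => (le_iSup (fun L : s => (L : IntermediateField k Ω)) L) hx)
  have hpow : ∀ (σ : Gal(E/k)) (L : s) (x : E), (x : Ω) ∈ M L → (σ ^ 2 ^ a L) x = x := by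
    intro σ L x hx
    have := hNM L
    have : @IsGalois ℚ _ (M L) _ (IntermediateField.algebra' (M L)) := (hMab L).toIsGalois
    let _ : Algebra (M L) E := (inclusion (hME L)).toRingHom.toAlgebra
    have : IsScalarTower ℚ (M L) E := IsScalarTower.of_algebraMap_eq fun q => by
      apply Subtype.ext
      simp
    let f := restrictRestrictAlgEquivMapHom ℚ (M L) k E
    have h1 : f (σ ^ 2 ^ a L) = 1 := by
      rw [map_pow, ← ha L, ← IsGalois.card_aut_eq_finrank]
      exact pow_card_eq_one'
    have h2 : algebraMap (M L) E (f (σ ^ 2 ^ a L) ⟨x, hx⟩) = (σ ^ 2 ^ a L) x :=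
      AlgEquiv.restrictNormal_commutes ((σ ^ 2 ^ a L).restrictScalars ℚ) (M L) ⟨x, hx⟩
    rw [← h2, h1]
    rfl
  have hp : IsPGroup 2 Gal(E/k) := by
    intro σ
    refine ⟨∑ L : s, a L, ?_⟩
    set τ := σ ^ 2 ^ ∑ L : s, a L with hτ
    -- E is generated over k by the fields M L. Each is fixed by τ, since the exponent 2 ^ ∑ a L is
    -- a multiple of the order 2 ^ a L of its Galois group.
    have hle : E ≤ lift (fixedField (Subgroup.zpowers τ)) := by
      refine iSup_le fun L => ?_
      rw [hLM L, adjoin_le_iff]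
      intro x hx
      refine ⟨⟨x, hME L hx⟩, ?_, rfl⟩
      have hτx : τ ⟨x, hME L hx⟩ = ⟨x, hME L hx⟩ := by
        have hdvd : 2 ^ a L ∣ 2 ^ ∑ L : s, a L :=
          pow_dvd_pow 2 (Finset.single_le_sum (fun _ _ => Nat.zero_le _) (Finset.mem_univ L))
        obtain ⟨c, hc⟩ := hdvd
        rw [hτ, hc, mul_comm, pow_mul]
        exact hpow (σ ^ c) L _ hx
      have hzle : Subgroup.zpowers τ ≤ MulAction.stabilizer Gal(E/k) (⟨x, hME L hx⟩ : E) := by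
        rw [Subgroup.zpowers_le]
        exact hτx
      rintro ⟨g, hg⟩
      exact hzle hg
    ext x
    obtain ⟨y, hy, hyx⟩ := hle x.2
    obtain rfl : y = x := Subtype.ext hyx
    exact congrArg Subtype.val (hy ⟨τ, Subgroup.mem_zpowers τ⟩)
  obtain ⟨b, hb⟩ := IsPGroup.iff_card.mp hp
  rw [IsGalois.card_aut_eq_finrank] at hb
  have hle : k⟮γ⟯ ≤ E := by
    rw [adjoin_simple_le_iff]
    exact hγE
  have hdvd : Module.finrank k k⟮γ⟯ ∣ 2 ^ b := by
    rw [← hb]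
    exact finrank_dvd_of_le_right hle
  obtain ⟨c, -, hc⟩ := (Nat.dvd_prime_pow Nat.prime_two).mp hdvd
  refine ⟨?_, c, hc⟩
  have := Algebra.IsIntegral.isIntegral (R := k) (⟨γ, hγE⟩ : E)
  exact this.map E.val

end Compositum

/-! ### Capitulation kernel and norms -/

section Kernel

open IntermediateField

/-- The class of `I` becomes trivial in an extension `B` exactly if the extension of `I` to `B` is
principal; the ring `B` need not be noetherian. -/
theorem extendedHom_mk0_eq_one_iff {A B : Type*} [CommRing A] [IsDedekindDomain A] [CommRing B]
    [IsDomain B] [Algebra A B] [Module.IsTorsionFree A B] (I : (Ideal A)⁰) :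
    ClassGroup.extendedHom A B (ClassGroup.mk0 I) = 1 ↔
      ((I : Ideal A).map (algebraMap A B)).IsPrincipal := by
  rw [ClassGroup.extendedHom_mk0', ClassGroup.mk_eq_one_iff,
    ← IsFractionRing.coeSubmodule_isPrincipal (R := B) (K := FractionRing B)]
  have h : ((Units.map (FractionalIdeal.extendedHom (FractionRing B) B).toMonoidHom
      (FractionalIdeal.mk0 (FractionRing A) I) : (FractionalIdeal B⁰ (FractionRing B))ˣ) :
      FractionalIdeal B⁰ (FractionRing B)) = ((I : Ideal A).map (algebraMap A B) : Ideal B) :=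
    FractionalIdeal.extendedHom_coeIdeal_eq_map (L := FractionRing B) (B := B) _
  rw [h, FractionalIdeal.coe_coeIdeal]

/-- Divisibility of algebraic integers does not depend on the ambient field. -/
theorem dvd_of_dvd_of_algebraMap_eq {K L Ω : Type*} [Field K] [Field L] [Field Ω] [Algebra K Ω]
    [Algebra L Ω] {x y : 𝓞 K} {x' y' : 𝓞 L} (hx : algebraMap K Ω x = algebraMap L Ω x')
    (hy : algebraMap K Ω y = algebraMap L Ω y') (h : x' ∣ y') : x ∣ y := by
  obtain ⟨w, rfl⟩ := h
  replace hy := hy.trans ((congrArg (algebraMap L Ω) (map_mul (algebraMap (𝓞 L) L) x' w)).trans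
    (map_mul _ _ _))
  rw [← hx] at hy
  by_cases hx0 : (x : K) = 0
  · rw [hx0, map_zero, zero_mul, map_eq_zero, NumberField.RingOfIntegers.coe_eq_zero_iff] at hy
    rw [hy]
    exact dvd_zero x
  · have hw : algebraMap K Ω ((y : K) / (x : K)) = algebraMap L Ω w := by
      rw [map_div₀, hy, mul_div_cancel_left₀]
      rwa [Ne, map_eq_zero]
    have hint : IsIntegral ℤ ((y : K) / (x : K)) := by
      rw [← isIntegral_algebraMap_iff (B := Ω) (algebraMap K Ω).injective, hw]
      exact (w.isIntegral_coe).map (algebraMap L Ω).toIntAlgHom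
    let z : 𝓞 K := ⟨_, hint⟩
    refine ⟨z, ?_⟩
    apply NumberField.RingOfIntegers.coe_injective
    exact (mul_div_cancel₀ (y : K) hx0).symm.trans (map_mul (algebraMap (𝓞 K) K) x z).symm

/-- If every element of `L` has `2`-power degree over `k`, then only classes of `2`-power order
capitulate in `L`. -/
theorem capitulationKernel_le_twoClassGroup {k Ω : Type*} [Field k] [NumberField k] [Field Ω]
    [Algebra k Ω] (L : IntermediateField k Ω)
    (hL : ∀ γ ∈ L, IsIntegral k γ ∧ ∃ a : ℕ, Module.finrank k k⟮γ⟯ = 2 ^ a) :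
    capitulationKernel k L ≤ twoClassGroup k := by
  intro c hc
  obtain ⟨I, rfl⟩ := ClassGroup.mk0_surjective c
  rw [capitulationKernel, MonoidHom.mem_ker, extendedHom_mk0_eq_one_iff] at hc
  obtain ⟨γ, hγ⟩ := hc
  rw [Ideal.submodule_span_eq] at hγ
  obtain ⟨hint, a, ha⟩ := hL γ (γ : L).2
  have := adjoin.finiteDimensional hint
  have : NumberField k⟮((γ : L) : Ω)⟯ := NumberField.of_module_finite k _
  set K := k⟮((γ : L) : Ω)⟯ with hK
  have hγK : IsIntegral ℤ (⟨γ, mem_adjoin_simple_self k _⟩ : K) := by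
    rw [← isIntegral_algebraMap_iff (B := Ω) (algebraMap K Ω).injective]
    exact (γ.isIntegral_coe).map (algebraMap L Ω).toIntAlgHom
  let δ : 𝓞 K := ⟨_, hγK⟩
  -- L may be infinite over k, so the equality I = (γ) is descended to K = k(γ) through h-th powers,
  -- h the class number: I ^ h = (b) turns it into an association of elements, and h-th roots of
  -- ideals of 𝓞 K are unique.
  obtain ⟨b, hb⟩ : ((I : Ideal (𝓞 k)) ^ Fintype.card (ClassGroup (𝓞 k))).IsPrincipal := by
    have h1 : ClassGroup.mk0 (I ^ Fintype.card (ClassGroup (𝓞 k))) = 1 := by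
      rw [map_pow, pow_card_eq_one]
    exact (ClassGroup.mk0_eq_one_iff (I ^ Fintype.card (ClassGroup (𝓞 k))).2).mp h1
  rw [Ideal.submodule_span_eq] at hb
  set h := Fintype.card (ClassGroup (𝓞 k)) with hh
  have hassoc : Associated (γ ^ h) (algebraMap (𝓞 k) (𝓞 L) b) := by
    rw [← Ideal.span_singleton_eq_span_singleton, ← Ideal.span_singleton_pow, ← hγ,
      ← Ideal.map_pow, hb, Ideal.map_span, Set.image_singleton]
  have hbK : algebraMap K Ω (algebraMap (𝓞 k) (𝓞 K) b) = algebraMap L Ω (algebraMap (𝓞 k) (𝓞 L) b) :=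
    rfl
  have hδ : algebraMap K Ω (δ ^ h : 𝓞 K) = algebraMap L Ω (γ ^ h : 𝓞 L) := by
    simp only [map_pow]
    rfl
  have hspan : (I : Ideal (𝓞 k)).map (algebraMap (𝓞 k) (𝓞 K)) = Ideal.span {δ} := by
    have hpow : ((I : Ideal (𝓞 k)).map (algebraMap (𝓞 k) (𝓞 K))) ^ h = Ideal.span {δ} ^ h := by
      rw [← Ideal.map_pow, hb, Ideal.map_span, Set.image_singleton, Ideal.span_singleton_pow,
        Ideal.span_singleton_eq_span_singleton]
      exact associated_of_dvd_dvd (dvd_of_dvd_of_algebraMap_eq (Ω := Ω) hbK hδ hassoc.symm.dvd)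
        (dvd_of_dvd_of_algebraMap_eq (Ω := Ω) hδ hbK hassoc.dvd)
    have hh0 : h ≠ 0 := Fintype.card_ne_zero
    exact dvd_antisymm
      ((UniqueFactorizationMonoid.pow_dvd_pow_iff_dvd hh0).mp hpow.dvd)
      ((UniqueFactorizationMonoid.pow_dvd_pow_iff_dvd hh0).mp hpow.symm.dvd)
  rw [twoClassGroup, CommGroup.mem_primaryComponent]
  refine ⟨a, ?_⟩
  -- The norm of the extension of I to K is I ^ [K : k], while that of (δ) is principal.
  have hnorm := congrArg (Ideal.relNorm (𝓞 k)) hspan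
  rw [Ideal.relNorm_algebraMap, Ideal.relNorm_singleton] at hnorm
  have hfin : Module.finrank (𝓞 k) (𝓞 K) = 2 ^ a := by
    rw [← ha, IsFractionRing.finrank_eq (𝓞 k) k (𝓞 K) K]
  rw [hfin] at hnorm
  rw [← map_pow, ClassGroup.mk0_eq_one_iff, SubmonoidClass.coe_pow, hnorm]
  exact ⟨_, rfl⟩

end Kernel

/-! ### Normality and degree of ℚ(√d, i) over ℚ -/

section Galois

open IntermediateField

theorem normal_adjoin_sqrt {K L : Type*} [Field K] [Field L] [CharZero K] [Algebra K L] {c : K}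
    {x : L} (hx : x ^ 2 = algebraMap K L c) : Normal K K⟮x⟯ := by
  by_cases h : x ∈ (⊥ : IntermediateField K L)
  · rw [adjoin_simple_eq_bot_iff.mpr h]
    exact Normal.of_algEquiv (botEquiv K L).symm
  · have : Algebra.IsQuadraticExtension K K⟮x⟯ :=
      ⟨finrank_adjoin_sqrt hx fun a ha => h (mem_bot.mpr ⟨a, ha⟩)⟩
    infer_instance

theorem normal_adjoin_sqrt_pair {K L : Type*} [Field K] [Field L] [CharZero K] [Algebra K L]
    {c c' : K} {x x' : L} (hx : x ^ 2 = algebraMap K L c) (hx' : x' ^ 2 = algebraMap K L c') :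
    Normal K (adjoin K {x, x'}) := by
  have := normal_adjoin_sqrt hx
  have := normal_adjoin_sqrt hx'
  rw [← Set.singleton_union, adjoin_union]
  infer_instance

theorem isGalois_biquadraticField (d : ℕ) : IsGalois ℚ (biquadraticField d) := by
  have : Normal ℚ (biquadraticField d) := by
    refine normal_adjoin_sqrt_pair (c := (d : ℚ)) (c' := -1) ?_ (by simp)
    rw [← Complex.ofReal_pow, Real.sq_sqrt (Nat.cast_nonneg d)]
    simp
  exact {}

theorem finrank_biquadraticField_dvd {d : ℕ} (hd : ¬ IsSquare d) :
    Module.finrank ℚ (biquadraticField d) ∣ 2 ^ 2 := by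
  rw [← Module.finrank_mul_finrank ℚ (gaussianSubfield d) (biquadraticField d),
    finrank_gaussianSubfield hd]
  have : Module.finrank ℚ (gaussianSubfield d) ≤ 2 :=
    finrank_adjoin_sqrt_le (c := -1) (x := imagElt d) (by rw [imagElt_sq]; simp)
  have : 0 < Module.finrank ℚ (gaussianSubfield d) := Module.finrank_pos
  generalize Module.finrank ℚ (gaussianSubfield d) = n at *
  interval_cases n <;> decide

end Galois

/-! ### The ramified ideals generate the 2-class group -/

section RamifiedIdeals

variable (d : ℕ)

/-- The embedding of `ℤ[i]` into the ring of integers of `ℚ(√d, i)`. -/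
def gaussianIntMap : GaussianInt →+* 𝓞 (biquadraticField d) :=
  (algebraMap (𝓞 (gaussianSubfield d)) (𝓞 (biquadraticField d))).comp
    (exists_gaussianInt_equiv d).choose.toRingHom

/-- `√d` as an algebraic integer of `ℚ(√d, i)`. -/
def sqrtInt : 𝓞 (biquadraticField d) :=
  ⟨sqrtElt d, IsIntegral.of_pow two_pos (by
    rw [sqrtElt_sq]
    exact isIntegral_algebraMap (R := ℤ) (x := (d : ℤ)) |> fun h => by simpa using h)⟩

theorem sqrtInt_sq : sqrtInt d ^ 2 = d := by
  apply NumberField.RingOfIntegers.coe_injective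
  rw [map_pow, map_natCast]
  exact sqrtElt_sq d

theorem gaussianIntMap_injective : Function.Injective (gaussianIntMap d) :=
  (FaithfulSMul.algebraMap_injective (𝓞 (gaussianSubfield d)) (𝓞 (biquadraticField d))).comp
    (exists_gaussianInt_equiv d).choose.injective

variable {d}

/-- The ideal `(a, √d)` of `ℚ(√d, i)` for a Gaussian integer `a ≠ 0`; if `a` is a prime divisor of
`d`, then this is the prime ideal whose square is `(a)`. -/
def ramifiedIdeal {a : GaussianInt} (ha : a ≠ 0) : (Ideal (𝓞 (biquadraticField d)))⁰ :=
  ⟨Ideal.span {gaussianIntMap d a, sqrtInt d}, by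
    rw [mem_nonZeroDivisors_iff_ne_zero]
    intro h
    have h1 : gaussianIntMap d a ∈ (0 : Ideal (𝓞 (biquadraticField d))) :=
      h ▸ Ideal.subset_span (Set.mem_insert _ _)
    rw [Ideal.zero_eq_bot, Ideal.mem_bot, map_eq_zero_iff _ (gaussianIntMap_injective d)] at h1
    exact ha h1⟩

theorem sqrtInt_sq_eq {a b : GaussianInt} (h : a * b = d) :
    sqrtInt d ^ 2 = gaussianIntMap d a * gaussianIntMap d b := by
  rw [sqrtInt_sq, ← map_mul, h, map_natCast]

theorem ramifiedIdeal_sq {a b : GaussianInt} (ha : a ≠ 0) (h : a * b = d) (hab : IsCoprime a b) :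
    (ramifiedIdeal (d := d) ha : Ideal (𝓞 (biquadraticField d))) ^ 2 =
      Ideal.span {gaussianIntMap d a} :=
  span_pair_sq_eq (sqrtInt_sq_eq h) (hab.map (gaussianIntMap d))

/-- An automorphism over ℚ(i) fixes a and sends √d to ±√d. -/
theorem conjIdeal_ramifiedIdeal {a : GaussianInt} (ha : a ≠ 0)
    (τ : Gal((biquadraticField d)/(gaussianSubfield d))) :
    conjIdeal τ (ramifiedIdeal ha) = ramifiedIdeal ha := by
  apply Subtype.ext
  change τ • Ideal.span {gaussianIntMap d a, sqrtInt d} =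
    Ideal.span {gaussianIntMap d a, sqrtInt d}
  have h1 : τ • gaussianIntMap d a = gaussianIntMap d a := by
    apply NumberField.RingOfIntegers.coe_injective
    exact τ.commutes _
  have h2 : τ • sqrtInt d = sqrtInt d ∨ τ • sqrtInt d = -sqrtInt d :=
    (conj_sqrtElt τ).imp (fun h => NumberField.RingOfIntegers.coe_injective h)
      (fun h => NumberField.RingOfIntegers.coe_injective h)
  rw [Ideal.pointwise_smul_def, Ideal.map_span, Set.image_pair]
  change Ideal.span {τ • gaussianIntMap d a, τ • sqrtInt d} = _
  rw [h1]
  rcases h2 with h2 | h2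
  · rw [h2]
  · rw [h2, Ideal.span_insert, Ideal.span_singleton_neg, ← Ideal.span_insert]

theorem mk0_prod_ramifiedIdeal_mem {ι : Type*} {ϖ : ι → GaussianInt} (hϖ : ∀ j, ϖ j ≠ 0)
    (S : Finset ι) : ClassGroup.mk0 (∏ j ∈ S, ramifiedIdeal (d := d) (hϖ j)) ∈
      stronglyAmbiguousClasses (gaussianSubfield d) (biquadraticField d) := by
  have h : ∀ τ : Gal((biquadraticField d)/(gaussianSubfield d)),
      conjIdeal τ (∏ j ∈ S, ramifiedIdeal (d := d) (hϖ j)) =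
        ∏ j ∈ S, ramifiedIdeal (d := d) (hϖ j) := by
    intro τ
    classical
    induction S using Finset.induction_on with
    | empty => exact conjIdeal_one τ
    | insert j S hj ih =>
      rw [Finset.prod_insert hj, conjIdeal_mul, ih, conjIdeal_ramifiedIdeal]
  refine ⟨fun τ => ?_, _, rfl, h⟩
  rw [conjClass_mk0, h τ]

instance : IsPrincipalIdealRing (𝓞 (gaussianSubfield d)) :=
  IsPrincipalIdealRing.of_surjective (exists_gaussianInt_equiv d).choose.toRingHom
    (exists_gaussianInt_equiv d).choose.surjective

instance : Finite (𝓞 (gaussianSubfield d))ˣ :=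
  Finite.of_equiv _ (Units.mapEquiv (exists_gaussianInt_equiv d).choose.toMulEquiv).toEquiv

theorem ambiguousClasses_le_twoClassGroup (hd : ¬ IsSquare d) :
    ambiguousClasses (gaussianSubfield d) (biquadraticField d) ≤
      twoClassGroup (biquadraticField d) := by
  intro c hc
  obtain ⟨σ, hσ1, hσ⟩ := exists_conj hd
  have := isGalois_gaussianSubfield hd
  rw [twoClassGroup, CommGroup.mem_primaryComponent]
  exact ⟨1, sq_eq_one_of_mem_ambiguousClasses σ hσ1 hσ hc⟩

theorem stronglyAmbiguousClasses_le_ambiguousClasses (F k : Type*) [Field F] [Field k]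
    [Algebra F k] [NumberField k] : stronglyAmbiguousClasses F k ≤ ambiguousClasses F k :=
  fun _ hc => hc.1

theorem isCoprime_prod_erase {R ι : Type*} [CommRing R] [IsDomain R] [IsPrincipalIdealRing R]
    [Fintype ι] [DecidableEq ι] {ϖ : ι → R} (hϖ : ∀ j, Prime (ϖ j))
    (hna : ∀ i j, i ≠ j → ¬ Associated (ϖ i) (ϖ j)) (j : ι) :
    IsCoprime (ϖ j) (∏ i ∈ Finset.univ.erase j, ϖ i) := by
  refine IsCoprime.prod_right fun i hi => ?_
  rw [(hϖ j).irreducible.coprime_iff_not_dvd, (hϖ j).dvd_prime_iff_associated (hϖ i)]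
  exact hna j i (Finset.ne_of_mem_erase hi).symm

/-- If `d` is the product of `t` pairwise non-associated Gaussian primes and the `2`-class group of
`ℚ(√d, i)` has at most `2 ^ (t - 2)` elements, then it is generated by the classes of the
ramified prime ideals. -/
theorem exists_mk0_prod_ramifiedIdeal_eq (hd : ¬ IsSquare d) {ι : Type*} [Fintype ι]
    {ϖ : ι → GaussianInt} (hϖ : ∀ j, Prime (ϖ j)) (hna : ∀ i j, i ≠ j → ¬ Associated (ϖ i) (ϖ j))
    (hprod : ∏ j, ϖ j = d)
    (hcard : 4 * Nat.card (twoClassGroup (biquadraticField d)) ≤ 2 ^ Fintype.card ι)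
    {c : ClassGroup (𝓞 (biquadraticField d))} (hc : c ∈ twoClassGroup (biquadraticField d)) :
    ∃ S : Finset ι,
      ClassGroup.mk0 (∏ j ∈ S, ramifiedIdeal (d := d) (hϖ j).ne_zero) = c := by
  classical
  have hsq : ∀ j, (ramifiedIdeal (d := d) (hϖ j).ne_zero : Ideal (𝓞 (biquadraticField d))) ^ 2 =
      Ideal.span {algebraMap (𝓞 (gaussianSubfield d)) (𝓞 (biquadraticField d))
        ((exists_gaussianInt_equiv d).choose (ϖ j))} := by
    intro j
    refine ramifiedIdeal_sq (hϖ j).ne_zero (b := ∏ i ∈ Finset.univ.erase j, ϖ i) ?_ ?_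
    · rw [Finset.mul_prod_erase _ _ (Finset.mem_univ j), hprod]
    · exact isCoprime_prod_erase hϖ hna j
  obtain ⟨σ, hσ1, hσ⟩ := exists_conj hd
  have := isGalois_gaussianSubfield hd
  have hle := card_le_four_mul_card_range (units_rank_le_one (finrank_biquadraticField_le hd))
    σ hσ1 hσ (ϖ := fun j => (exists_gaussianInt_equiv d).choose (ϖ j))
    (fun j => (MulEquiv.prime_iff (exists_gaussianInt_equiv d).choose).mpr (hϖ j))
    (fun i j hij h => hna i j hij (by
      have := h.map (exists_gaussianInt_equiv d).choose.symm
      simpa using this)) hsq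
  set R := Set.range fun S : Finset ι =>
    ClassGroup.mk0 (∏ j ∈ S, ramifiedIdeal (d := d) (hϖ j).ne_zero) with hR
  have hsub : R ⊆ twoClassGroup (biquadraticField d) := by
    rintro _ ⟨S, rfl⟩
    exact ambiguousClasses_le_twoClassGroup hd (mk0_prod_ramifiedIdeal_mem _ S).1
  -- R has at least 2 ^ (t - 2) elements, t being the number of primes, and lies in a group with at
  -- most that many.
  have heq : R = twoClassGroup (biquadraticField d) := by
    refine Set.eq_of_subset_of_ncard_le hsub ?_
    rw [← Nat.card_coe_set_eq]
    change Nat.card (twoClassGroup (biquadraticField d)) ≤ _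
    omega
  have hcR : c ∈ R := heq ▸ hc
  exact hcR

end RamifiedIdeals

/-! ### Capitulation of the ramified ideals -/

section Capitulates

/-- A ramified prime ideal capitulates in an extension in which its Gaussian generator becomes a
square up to a unit. -/
theorem extendedHom_mk0_ramifiedIdeal {d : ℕ} {G : Type*} [Field G]
    [Algebra (biquadraticField d) G] {a b : GaussianInt} (ha : a ≠ 0)
    (h : a * b = d) (hab : IsCoprime a b) {α v : 𝓞 G} (hv : IsUnit v)
    (hα : α ^ 2 = v * algebraMap (𝓞 (biquadraticField d)) (𝓞 G) (gaussianIntMap d a)) :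
    ClassGroup.extendedHom (𝓞 (biquadraticField d)) (𝓞 G)
      (ClassGroup.mk0 (ramifiedIdeal (d := d) ha)) = 1 := by
  rw [extendedHom_mk0_eq_one_iff]
  change ((Ideal.span {gaussianIntMap d a, sqrtInt d}).map _).IsPrincipal
  rw [Ideal.map_span, Set.image_pair]
  have hφ := (FaithfulSMul.algebraMap_injective (𝓞 (biquadraticField d)) (𝓞 G)).comp
    (gaussianIntMap_injective d)
  rw [span_pair_eq_span_of_sq hv (b := algebraMap _ (𝓞 G) (gaussianIntMap d b)) ?_ ?_ ?_ hα]
  · exact ⟨α, rfl⟩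
  · exact fun h0 => ha (hφ (by simpa using h0))
  · rw [← map_pow, sqrtInt_sq_eq h, map_mul]
  · exact (hab.map (gaussianIntMap d)).map _

/-- The square root of a natural number, as an algebraic integer in a subfield of `ℂ`. -/
theorem exists_sq_eq_natCast {k : Type*} [Field k] [Algebra k ℂ] (G : IntermediateField k ℂ)
    {n : ℕ} (h : ((Real.sqrt n : ℝ) : ℂ) ∈ G) : ∃ s : 𝓞 G, s ^ 2 = n := by
  have hsq : (⟨_, h⟩ : G) ^ 2 = n := by
    apply Subtype.ext
    change ((Real.sqrt n : ℝ) : ℂ) ^ 2 = ((n : G) : ℂ)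
    rw [← Complex.ofReal_pow, Real.sq_sqrt (Nat.cast_nonneg n)]
    simp
  have hint : IsIntegral ℤ (⟨_, h⟩ : G) := IsIntegral.of_pow two_pos (by
    rw [hsq]
    exact isIntegral_algebraMap (R := ℤ) (x := (n : ℤ)) |> fun h => by simpa using h)
  refine ⟨⟨_, hint⟩, ?_⟩
  apply NumberField.RingOfIntegers.coe_injective
  rw [map_natCast]
  exact hsq

end Capitulates

section GaussianPrimes

theorem not_associated_of_dvd_coprime {m n : ℕ} (hmn : Nat.Coprime m n) {x y : GaussianInt}
    (hx : Prime x) (hxm : x ∣ m) (hyn : y ∣ n) : ¬ Associated x y := by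
  intro h
  have hc : IsCoprime (m : GaussianInt) (n : GaussianInt) := hmn.cast
  exact hx.not_isUnit (hc.isUnit_of_dvd' hxm (h.dvd.trans hyn))

end GaussianPrimes

section SquareRootsOfGaussianPrimes

variable {G : Type*} [Field G] [CharZero G]

/-- Conjugating x + i = uπz² gives the same relation for π̄ and x - i, which has the same trace and
norm. -/
theorem exists_sq_eq_unit_mul_and_star (φ : GaussianInt →+* 𝓞 G) {p : ℕ} {s : 𝓞 G}
    (hs : s ^ 2 = p) {x y : ℤ} (hxy : x ^ 2 + 1 = p * y ^ 2) {π z u : GaussianInt}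
    (hu : IsUnit u) (h : (⟨x, 1⟩ : GaussianInt) = u * π * z ^ 2) :
    (∃ α v : 𝓞 G, IsUnit v ∧ α ^ 2 = v * φ π) ∧
      ∃ α v : 𝓞 G, IsUnit v ∧ α ^ 2 = v * φ (star π) := by
  set w : GaussianInt := ⟨x, 1⟩ with hw
  have hadd : w + star w = 2 * x := by
    rw [Zsqrtd.ext_iff]
    constructor <;> simp [hw, two_mul]
  have hmul : w * star w = p * y ^ 2 := by
    have : w * star w = ((x * x + 1 : ℤ) : GaussianInt) := by
      rw [Zsqrtd.ext_iff]
      constructor <;> simp [hw]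
    rw [this, ← sq, hxy]
    push_cast
    ring
  constructor
  · exact exists_sq_eq_unit_mul φ hs hxy hadd hmul hu h
  · refine exists_sq_eq_unit_mul φ hs hxy (w := star w) (z := star z) (u := star u) ?_ ?_ ?_ ?_
    · rw [star_star, add_comm, hadd]
    · rw [star_star, mul_comm, hmul]
    · exact hu.map (starRingEnd GaussianInt)
    · rw [h]
      simp [mul_comm, mul_left_comm]

end SquareRootsOfGaussianPrimes

theorem not_isSquare_mul_of_coprime {p n : ℕ} (hp : p.Prime) (h : Nat.Coprime p n) :
    ¬ IsSquare (p * n) := by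
  rintro ⟨m, hm⟩
  have h1 : p ∣ m := by
    have : p ∣ m * m := hm ▸ dvd_mul_right p n
    exact (hp.dvd_mul.mp this).elim id id
  obtain ⟨t, rfl⟩ := h1
  have h2 : n = p * (t * t) := Nat.eq_of_mul_eq_mul_left hp.pos (by rw [hm]; ring)
  exact hp.coprime_iff_not_dvd.mp h ⟨_, h2⟩

end Capitulation

end

/-! ### The main theorem -/

open Capitulation in
theorem corollary6p9 (p₁ p₂ q : ℕ) (hp₁ : p₁.Prime) (hp₂ : p₂.Prime) (hq : q.Prime)
    (hne : p₁ ≠ p₂) (hp₁4 : p₁ ≡ 1 [MOD 4]) (hp₂4 : p₂ ≡ 1 [MOD 4]) (hq4 : q ≡ 3 [MOD 4])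
    (htype : Nonempty (twoClassGroup (biquadraticField (p₁ * p₂ * q)) ≃*
      Multiplicative (ZMod 2 × ZMod 2 × ZMod 2))) :
    let k := biquadraticField (p₁ * p₂ * q)
    let F := gaussianSubfield (p₁ * p₂ * q)
    (∀ c ∈ twoClassGroup k,
      ClassGroup.extendedHom (𝓞 k) (𝓞 (genusField k ℂ)) c = 1) ∧
    capitulationKernel k (genusField k ℂ) = twoClassGroup k ∧
    twoClassGroup k = ambiguousClasses F k ∧
    ambiguousClasses F k = stronglyAmbiguousClasses F k := by
  intro k F
  have hp₁4' : p₁ % 4 = 1 := hp₁4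
  have hp₂4' : p₂ % 4 = 1 := hp₂4
  have hq4' : q % 4 = 3 := hq4
  have h12 : Nat.Coprime p₁ p₂ := (Nat.coprime_primes hp₁ hp₂).mpr hne
  have h1q : Nat.Coprime p₁ q := (Nat.coprime_primes hp₁ hq).mpr (by rintro rfl; omega)
  have h2q : Nat.Coprime p₂ q := (Nat.coprime_primes hp₂ hq).mpr (by rintro rfl; omega)
  have hd : ¬ IsSquare (p₁ * p₂ * q) := by
    rw [mul_assoc]
    exact not_isSquare_mul_of_coprime hp₁ (h12.mul_right h1q)
  obtain ⟨x₁, y₁, π₁, z₁, u₁, hxy₁, hπ₁, hπ₁', hna₁, hmul₁, hu₁, hw₁⟩ :=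
    exists_gaussian_prime hp₁ hp₁4
  obtain ⟨x₂, y₂, π₂, z₂, u₂, hxy₂, hπ₂, hπ₂', hna₂, hmul₂, hu₂, hw₂⟩ :=
    exists_gaussian_prime hp₂ hp₂4
  have := Fact.mk hq
  have hqp : Prime (q : GaussianInt) := GaussianInt.prime_of_nat_prime_of_mod_four_eq_three q hq4'
  let ϖ : Fin 5 → GaussianInt := ![π₁, star π₁, π₂, star π₂, q]
  have hϖ : ∀ j, Prime (ϖ j) := by
    intro j
    fin_cases j
    exacts [hπ₁, hπ₁', hπ₂, hπ₂', hqp]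
  let n : Fin 5 → ℕ := ![p₁, p₁, p₂, p₂, q]
  have hdvd : ∀ j, ϖ j ∣ (n j : GaussianInt) := by
    intro j
    fin_cases j
    exacts [⟨_, hmul₁.symm⟩, ⟨_, hmul₁.symm.trans (mul_comm _ _)⟩, ⟨_, hmul₂.symm⟩,
      ⟨_, hmul₂.symm.trans (mul_comm _ _)⟩, dvd_rfl]
  have hna : ∀ i j, i ≠ j → ¬ Associated (ϖ i) (ϖ j) := by
    intro i j hij
    by_cases hc : Nat.Coprime (n i) (n j)
    · exact not_associated_of_dvd_coprime hc (hϖ i) (hdvd i) (hdvd j)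
    · fin_cases i <;> fin_cases j <;>
        first
        | exact absurd rfl hij
        | exact hna₁
        | exact fun h => hna₁ h.symm
        | exact hna₂
        | exact fun h => hna₂ h.symm
        | exact absurd h12 hc
        | exact absurd h12.symm hc
        | exact absurd h1q hc
        | exact absurd h1q.symm hc
        | exact absurd h2q hc
        | exact absurd h2q.symm hc
  have hprod : ∏ j, ϖ j = ((p₁ * p₂ * q : ℕ) : GaussianInt) := by
    push_cast
    rw [← hmul₁, ← hmul₂]
    simp [ϖ, Fin.prod_univ_succ, mul_assoc]
  have hcard : Nat.card (twoClassGroup k) = 8 := by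
    obtain ⟨e⟩ := htype
    rw [Nat.card_congr e.toEquiv]
    simp
  have hgen := fun {c : ClassGroup (𝓞 k)} (hc : c ∈ twoClassGroup k) =>
    -- The numerical condition is 4 · 8 ≤ 2 ^ 5, an equality: this is where the type (2, 2, 2)
    -- enters.
    exists_mk0_prod_ramifiedIdeal_eq hd hϖ hna hprod (by rw [hcard]; decide) hc
  obtain ⟨s₁, hs₁⟩ := exists_sq_eq_natCast _ (sqrt_mem_genusField hp₁ (mul_assoc p₁ p₂ q) hp₁4'
    (by rw [Nat.mul_mod, hp₂4', hq4']) (h12.mul_right h1q))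
  obtain ⟨s₂, hs₂⟩ := exists_sq_eq_natCast _ (sqrt_mem_genusField hp₂
    (show p₁ * p₂ * q = p₂ * (p₁ * q) by ring) hp₂4'
    (by rw [Nat.mul_mod, hp₁4', hq4']) (h12.symm.mul_right h2q))
  obtain ⟨s₃, hs₃⟩ := exists_sq_eq_natCast _ (sqrt_mem_genusField' hq (mul_comm (p₁ * p₂) q) hq4'
    (by rw [Nat.mul_mod, hp₁4', hp₂4']) (h1q.symm.mul_right h2q.symm))
  let φ : GaussianInt →+* 𝓞 (genusField k ℂ) :=
    (algebraMap (𝓞 k) (𝓞 (genusField k ℂ))).comp (gaussianIntMap (p₁ * p₂ * q))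
  have hα : ∀ j, ∃ α v : 𝓞 (genusField k ℂ), IsUnit v ∧ α ^ 2 = v * φ (ϖ j) := by
    intro j
    fin_cases j
    · exact (exists_sq_eq_unit_mul_and_star φ hs₁ hxy₁ hu₁ hw₁).1
    · exact (exists_sq_eq_unit_mul_and_star φ hs₁ hxy₁ hu₁ hw₁).2
    · exact (exists_sq_eq_unit_mul_and_star φ hs₂ hxy₂ hu₂ hw₂).1
    · exact (exists_sq_eq_unit_mul_and_star φ hs₂ hxy₂ hu₂ hw₂).2
    -- The inert prime q needs no Pell argument, being the square of √q.
    · refine ⟨s₃, 1, isUnit_one, ?_⟩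
      rw [one_mul, hs₃]
      exact (map_natCast φ q).symm
  have hcap : ∀ c ∈ twoClassGroup k,
      ClassGroup.extendedHom (𝓞 k) (𝓞 (genusField k ℂ)) c = 1 := by
    intro c hc
    obtain ⟨S, rfl⟩ := hgen hc
    rw [map_prod, map_prod]
    refine Finset.prod_eq_one fun j _ => ?_
    obtain ⟨α, v, hv, h⟩ := hα j
    exact extendedHom_mk0_ramifiedIdeal _
      (b := ∏ i ∈ Finset.univ.erase j, ϖ i)
      (by rw [Finset.mul_prod_erase _ _ (Finset.mem_univ j), hprod])
      (isCoprime_prod_erase hϖ hna j) hv h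
  have hsub : twoClassGroup k ≤ stronglyAmbiguousClasses F k := by
    intro c hc
    obtain ⟨S, rfl⟩ := hgen hc
    exact mk0_prod_ramifiedIdeal_mem _ S
  have hle := ambiguousClasses_le_twoClassGroup hd
  have hle' := stronglyAmbiguousClasses_le_ambiguousClasses F k
  have := isGalois_biquadraticField (p₁ * p₂ * q)
  refine ⟨hcap, le_antisymm ?_ hcap, le_antisymm (hsub.trans hle') hle,
    le_antisymm (hle.trans hsub) hle'⟩
  exact capitulationKernel_le_twoClassGroup _ fun γ hγ =>
    exists_finrank_adjoin_eq_two_pow (finrank_biquadraticField_dvd hd) hγ
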